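/- Let $\mathbb F_q$ be a finite field with $q$ elements, let $V=\mathbb F_q^n$ be the natural $GL_n(q)$-module, and let $\mathrm{Det}$ be the one-dimensional determinant module of $GL_n(q)$. Let $I=(n_1,\ldots,n_\ell)$ be a composition of $n$ into positive parts, put $m_i=n_1+\cdots+n_i$, and let $P_I\le GL_n(q)$ be the standard parabolic subgroup of invertible block upper triangular matrices with diagonal blocks of sizes $n_1,\ldots,n_\ell$. Let $1\le k\le q-2$. Then the Hilbert series of the space of invariants $(S^\bullet(V)\otimes\wedge^\bullet(V)\otimes\mathrm{Det}^k)^{P_I}$, bi-graded by the degrees in the symmetric algebra $S^\bullet(V)$ and the exterior algebra $\wedge^\bullet(V)$, is $$\sum_{i,j\ge 0} t^i s^j \dim_{\mathbb F_q}\big(S^i(V)\otimes\wedge^j(V)\otimes\mathrm{Det}^k\big)^{P_I} = t^{(q-2-k)\frac{q^n-1}{q-1}}\cdot\frac{\prod_{i=0}^{n-1}(s+t^{q^i})}{\prod_{i=1}^{\ell}\prod_{j=1}^{n_i}\big(1-t^{q^{m_i}-q^{m_i-j}}\big)}$$ as formal power series in $t$ and $s$. -/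

import Mathlib

open scoped TensorProduct

noncomputable section

namespace DicksonMui

section Reps

variable (F : Type*) [Field F] (n : ℕ)

/-- The natural module `V = F ^ n` of `GL_n(F)` (column vectors, `g • v = g v`). -/
def stdRep : Representation F (Matrix.GeneralLinearGroup (Fin n) F) (Fin n → F) where
  toFun g := Matrix.mulVecLin (g : Matrix (Fin n) (Fin n) F)
  map_one' := by simp only [Units.val_one, Matrix.mulVecLin_one]; rfl
  map_mul' g h := by simp only [Units.val_mul, Matrix.mulVecLin_mul]; rfl

variable {F} {V : Type*} [AddCommGroup V] [Module F V]

/-- The functoriality of the symmetric algebra. -/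
def symMap (f : V →ₗ[F] V) : SymmetricAlgebra F V →ₐ[F] SymmetricAlgebra F V :=
  SymmetricAlgebra.lift (SymmetricAlgebra.ι F V ∘ₗ f)

theorem symMap_id : symMap (LinearMap.id : V →ₗ[F] V) = AlgHom.id F _ := by
  apply SymmetricAlgebra.algHom_ext
  ext v
  simp [symMap]

theorem symMap_comp (f g : V →ₗ[F] V) : symMap (f ∘ₗ g) = (symMap f).comp (symMap g) := by
  apply SymmetricAlgebra.algHom_ext
  ext v
  simp [symMap]

variable (F V) in
/-- The homogeneous component `S ^ i (V)` of the symmetric algebra: the span of the products of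
`i` elements of `V`. -/
abbrev symPow (i : ℕ) : Submodule F (SymmetricAlgebra F V) :=
  LinearMap.range (SymmetricAlgebra.ι F V) ^ i

theorem symPow_le_comap (f : V →ₗ[F] V) (i : ℕ) :
    symPow F V i ≤ (symPow F V i).comap (symMap f).toLinearMap := by
  rw [← Submodule.map_le_iff_le_comap, Submodule.map_pow]
  refine pow_le_pow_left' ?_ i
  rintro _ ⟨_, ⟨v, rfl⟩, rfl⟩
  exact ⟨f v, by simp [symMap]⟩

variable {G : Type*} [Group G]

/-- The representation on the whole symmetric algebra `S(V)` induced from one on `V`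
(acting by algebra automorphisms). -/
def symAlgRep (ρ : Representation F G V) : Representation F G (SymmetricAlgebra F V) where
  toFun g := (symMap (ρ g)).toLinearMap
  map_one' := by
    rw [map_one, Module.End.one_eq_id, symMap_id]; rfl
  map_mul' g h := by
    rw [map_mul, Module.End.mul_eq_comp, symMap_comp]; rfl

/-- The representation on `S ^ i (V)` induced from one on `V`. -/
def symPowRep (ρ : Representation F G V) (i : ℕ) : Representation F G (symPow F V i) :=
  (symAlgRep ρ).subrepresentation (symPow F V i) fun g => symPow_le_comap (ρ g) i

/-- The representation on the exterior power `∧ ^ j (V)` induced from one on `V`. -/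
def extPowRep (ρ : Representation F G V) (j : ℕ) : Representation F G (⋀[F]^j V) where
  toFun g := exteriorPower.map j (ρ g)
  map_one' := by
    rw [map_one, Module.End.one_eq_id, exteriorPower.map_id]; rfl
  map_mul' g h := by
    rw [map_mul, Module.End.mul_eq_comp, Module.End.mul_eq_comp, exteriorPower.map_comp]

variable (F)

/-- The one-dimensional module `Det ^ k` of `GL_n(F)`. -/
def detPowRep (k : ℕ) : Representation F (Matrix.GeneralLinearGroup (Fin n) F) F where
  toFun g := ((g : Matrix (Fin n) (Fin n) F).det ^ k) • LinearMap.id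
  map_one' := by ext; simp
  map_mul' g h := by ext; simp [mul_pow, mul_comm]

variable {n}

/-- The standard parabolic subgroup `P_I` of `GL_n(F)`: the invertible block upper triangular
matrices, for the division of the rows and columns into consecutive blocks whose sizes are the
parts of the composition `I`. -/
def parabolic (I : Composition n) : Subgroup (Matrix.GeneralLinearGroup (Fin n) F) where
  carrier := {g | (g : Matrix (Fin n) (Fin n) F).BlockTriangular I.index}
  one_mem' := by
    simpa using Matrix.blockTriangular_one
  mul_mem' {g h} hg hh := by
    simpa using Matrix.BlockTriangular.mul hg hh
  inv_mem' {g} hg := by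
    have : Invertible (g : Matrix (Fin n) (Fin n) F) := g.invertible
    simpa using Matrix.blockTriangular_inv_of_blockTriangular hg

variable {F} in
/-- The invariants `(A ⊗ B ⊗ Det ^ k) ^ {P_I}`, for `GL_n(F)`-modules `A` and `B`. -/
def tensorDetInvariants {A B : Type*} [AddCommGroup A] [Module F A] [AddCommGroup B] [Module F B]
    (ρ : Representation F (Matrix.GeneralLinearGroup (Fin n) F) A)
    (σ : Representation F (Matrix.GeneralLinearGroup (Fin n) F) B)
    (I : Composition n) (k : ℕ) : Submodule F ((A ⊗[F] B) ⊗[F] F) :=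
  Representation.invariants (((ρ.tprod σ).tprod (detPowRep F n k)).comp (parabolic F I).subtype)

/-- The bihomogeneous component `(S ^ i (V) ⊗ ∧ ^ j (V) ⊗ Det ^ k) ^ {P_I}` of the space of
`P_I`-invariants, with `V = F ^ n`. -/
abbrev gradedInvariants (I : Composition n) (k i j : ℕ) :=
  tensorDetInvariants (symPowRep (stdRep F n) i) (extPowRep (stdRep F n) j) I k

instance (i : ℕ) : Module.Finite F (symPow F (Fin n → F) i) :=
  Module.Finite.iff_fg.mpr
    ((Module.Finite.iff_fg.mp (Module.Finite.range (SymmetricAlgebra.ι F (Fin n → F)))).pow i)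

instance {A B : Type*} [AddCommGroup A] [Module F A] [AddCommGroup B] [Module F B]
    [Module.Finite F A] [Module.Finite F B]
    (ρ : Representation F (Matrix.GeneralLinearGroup (Fin n) F) A)
    (σ : Representation F (Matrix.GeneralLinearGroup (Fin n) F) B)
    (I : Composition n) (k : ℕ) : Module.Finite F (tensorDetInvariants ρ σ I k) :=
  inferInstance

/-- So the dimensions in the Hilbert series below are dimensions of finite-dimensional spaces. -/
instance (I : Composition n) (k i j : ℕ) : Module.Finite F (gradedInvariants F I k i j) :=
  inferInstance

/-- The Hilbert series `∑ t ^ i s ^ j dim (S ^ i (V) ⊗ ∧ ^ j (V) ⊗ Det ^ k) ^ {P_I}`, a formal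
power series in two variables, `t` being the variable `0` and `s` the variable `1`. -/
def hilbertSeries (I : Composition n) (k : ℕ) : MvPowerSeries (Fin 2) ℚ :=
  fun d => (Module.finrank F (gradedInvariants F I k (d 0) (d 1)) : ℚ)

end Reps

end DicksonMui

end

/-!
Let `S = S(V)` be the polynomial ring, `P` the parabolic subgroup and `q` the order of the field.

*Reduction to polynomials.* The Frobenius powers `v ↦ v ^ (q ^ a)` are equivariant linear maps from
`V` to `S`. Evaluating the exterior product of those with exponents in a `j`-element subset `s` of
`{0, …, n - 1}` therefore gives an equivariant map `pairing` from `S ⊗ ∧ ^ j (V)` to `S`, which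
raises the degree by `∑ a ∈ s, q ^ a`. All these maps together are given by the matrix of the
`j`-minors of the Moore matrix `X b ^ (q ^ a)`. By Laplace expansion, this matrix and that of the
complementary minors have as product the Moore determinant `L` times the unit matrix
(`compound_mul_cofactors`). So a tensor is determined by its pairings, and any family of multiples
of `L` is the family of pairings of a tensor. A tensor is an invariant of
`S ⊗ ∧ ^ j (V) ⊗ Det ^ k` if and only if its pairings are invariants of `S ⊗ Det ^ k`.

*Semi-invariants.* The determinant `L` is a product of linear forms, one for each line of `V`, and
`g L = det g • L`. Each of these linear forms is scaled by reflections of any nonzero determinant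
that lie in `P`, so it divides every invariant of `S ⊗ Det ^ k` if `q - 1` does not divide `k`.
By iteration, for `1 ≤ k ≤ q - 2`, these invariants are the products `L ^ (q - 1 - k) h` with `h`
an invariant of `S` (`mem_semiInv_iff`). In particular they are multiples of `L`, and
`gradedInvariantsToPi_bijective` identifies the invariants in question with the families of
homogeneous semi-invariants indexed by the sets `s`. This accounts for the numerator of the
Hilbert series.

*Invariants.* For a member `V_m` of the flag of `P`, the polynomial with roots the elements of
`V_m` is additive, and its coefficients are invariant. It is the composite of the polynomial for the
preceding member with a further additive polynomial, and the coefficients of the latter, for all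
blocks, are `n` invariants (`parGen`). Over the ring `R` generated by them `S` is integral, so they
are algebraically independent and `R` is integrally closed. The field of fractions of `S` is a
Galois extension of that of `R`, and automorphisms permute the elements of each member of the flag,
so they come from `P`. Hence `R` is the whole ring of invariants (`mem_semiInv_zero_iff`), and its
Hilbert series is the reciprocal of the product over the degrees of the generators.
-/

open scoped TensorProduct

noncomputable section

namespace DicksonMui

/-! ### Additive polynomials of a flag -/

section FlagPolynomials

open Polynomial

variable (F : Type*) [Field F] [Fintype F] {A : Type*} [CommRing A] [Algebra F A]

/-- The identity `∏ (T - c) = T ^ q - T` over the finite field, made homogeneous. -/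
theorem prod_sub_smul [IsDomain A] (T c : A) :
    ∏ l : F, (T - l • c) = T ^ Fintype.card F - c ^ (Fintype.card F - 1) * T := by
  have hq : Fintype.card F - 1 + 1 = Fintype.card F :=
    Nat.sub_add_cancel Fintype.card_pos
  have hq' : Fintype.card F - 1 ≠ 0 := by have := Fintype.one_lt_card (α := F); omega
  rcases eq_or_ne c 0 with rfl | hc
  · simp [hq']
  have hinj := FaithfulSMul.algebraMap_injective A (FractionRing A)
  apply hinj
  set φ := algebraMap A (FractionRing A)
  have hc' : φ c ≠ 0 := fun h => hc (hinj (by rw [h, map_zero]))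
  have hpoly : ∏ l : F, (X - C l : F[X]) = X ^ Fintype.card F - X := by
    have hm : (X ^ Fintype.card F - X : F[X]).Monic :=
      monic_X_pow_sub (by simpa using Fintype.one_lt_card (α := F))
    have h := FiniteField.roots_X_pow_card_sub_X F
    have := prod_multiset_X_sub_C_of_monic_of_roots_card_eq hm (by
      rw [h, FiniteField.X_pow_card_sub_X_natDegree_eq F Fintype.one_lt_card]; rfl)
    rw [h] at this
    exact this
  have h1 := congrArg (aeval (φ T / φ c)) hpoly
  simp only [map_prod, map_sub, aeval_X, aeval_C, map_pow] at h1
  have h2 : ∀ l : F, φ (T - l • c) = φ c * (φ T / φ c - algebraMap F (FractionRing A) l) := by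
    intro l
    rw [mul_sub, mul_div_cancel₀ _ hc', map_sub, Algebra.smul_def, map_mul,
      ← IsScalarTower.algebraMap_apply, mul_comm]
  rw [map_prod, Finset.prod_congr rfl fun l _ => h2 l, Finset.prod_mul_distrib, h1,
    Finset.prod_const, Finset.card_univ, map_sub, map_mul, map_pow, map_pow, mul_sub, div_pow,
    mul_div_cancel₀ _ (pow_ne_zero _ hc')]
  rw [← hq, Nat.add_sub_cancel, pow_succ (φ c)]
  field_simp

/-- The composite of the additive polynomials `X ^ q - c a X` for `m ≤ a < m + l`, where `q` is
the order of `F`. -/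
def addPoly (c : ℕ → A) (m : ℕ) : ℕ → A[X]
  | 0 => X
  | l + 1 => addPoly c m l ^ Fintype.card F - C (c (m + l)) * addPoly c m l

/-- The coefficient of `X ^ (q ^ j)` in `addPoly F c m l`. -/
def addCoeff (c : ℕ → A) (m : ℕ) : ℕ → ℕ → A
  | 0, j => if j = 0 then 1 else 0
  | l + 1, 0 => -(c (m + l) * addCoeff c m l 0)
  | l + 1, j + 1 => addCoeff c m l j ^ Fintype.card F - c (m + l) * addCoeff c m l (j + 1)

/-- The coefficients `c a` for which `addPoly F c 0 m` is the monic polynomial with roots the span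
of `x 0, …, x (m - 1)`: `c a` is the `(q - 1)`-st power of the value at `x a` of the polynomial for
`x 0, …, x (a - 1)`. -/
def flagCoeff (x : ℕ → A) : ℕ → A :=
  let rec aux : ℕ → A[X] × A
    | 0 => (X, x 0 ^ (Fintype.card F - 1))
    | a + 1 =>
      let D := (aux a).1 ^ Fintype.card F - C (aux a).2 * (aux a).1
      (D, D.eval (x (a + 1)) ^ (Fintype.card F - 1))
  fun a => (aux a).2

omit [Field F] [Algebra F A] in
theorem flagCoeff_eq (x : ℕ → A) (a : ℕ) :
    flagCoeff F x a = (addPoly F (flagCoeff F x) 0 a).eval (x a) ^ (Fintype.card F - 1) := by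
  have h : ∀ a, (flagCoeff.aux F x a).1 = addPoly F (flagCoeff F x) 0 a := by
    intro a
    induction a with
    | zero => rfl
    | succ a ih =>
      change (flagCoeff.aux F x a).1 ^ Fintype.card F - C (flagCoeff F x a) *
        (flagCoeff.aux F x a).1 = _
      rw [ih, addPoly, zero_add]
  cases a with
  | zero => simp [flagCoeff, flagCoeff.aux, addPoly]
  | succ a => rw [← h]; rfl

omit [Field F] [Algebra F A] in
theorem addPoly_comp (c : ℕ → A) (m l : ℕ) :
    (addPoly F c m l).comp (addPoly F c 0 m) = addPoly F c 0 (m + l) := by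
  induction l with
  | zero => simp [addPoly]
  | succ l ih => rw [addPoly, sub_comp, pow_comp, mul_comp, ih, C_comp, ← add_assoc, addPoly,
      zero_add]

theorem addPoly_comp_X_sub_C (c : ℕ → A) (m l : ℕ) (y : A) :
    (addPoly F c m l).comp (X - C y) = addPoly F c m l - C ((addPoly F c m l).eval y) := by
  induction l with
  | zero => simp [addPoly]
  | succ l ih =>
    have h := map_sub (FiniteField.frobeniusAlgHom F A[X]) (addPoly F c m l)
      (C ((addPoly F c m l).eval y))
    simp only [FiniteField.frobeniusAlgHom_apply] at h
    rw [addPoly, sub_comp, pow_comp, mul_comp, ih, h]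
    simp only [C_comp, eval_sub, eval_pow, eval_mul, eval_C, C_sub, C_pow, C_mul]
    ring

theorem addPoly_eval_smul (c : ℕ → A) (m l : ℕ) (r : F) (y : A) :
    (addPoly F c m l).eval (r • y) = r • (addPoly F c m l).eval y := by
  induction l with
  | zero => simp [addPoly]
  | succ l ih =>
    rw [addPoly]
    simp only [eval_sub, eval_pow, eval_mul, eval_C, ih, _root_.smul_pow, FiniteField.pow_card,
      smul_sub,
      mul_smul_comm]

omit [Algebra F A] in
theorem addCoeff_eq_zero (c : ℕ → A) (m : ℕ) {l j : ℕ} (h : l < j) : addCoeff F c m l j = 0 := by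
  induction l generalizing j with
  | zero => simp [addCoeff, h.ne']
  | succ l ih =>
    obtain ⟨j, rfl⟩ := Nat.exists_eq_succ_of_ne_zero (Nat.ne_zero_of_lt h)
    rw [Nat.succ_eq_add_one, addCoeff, ih (by omega), ih (by omega),
      zero_pow Fintype.card_ne_zero, mul_zero, sub_zero]

omit [Algebra F A] in
theorem addCoeff_self (c : ℕ → A) (m l : ℕ) : addCoeff F c m l l = 1 := by
  induction l with
  | zero => simp [addCoeff]
  | succ l ih => rw [addCoeff, ih, addCoeff_eq_zero F c m (Nat.lt_succ_self l)]; simp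

theorem addPoly_eq_sum (c : ℕ → A) (m l : ℕ) :
    addPoly F c m l = ∑ j ∈ Finset.range (l + 1),
      C (addCoeff F c m l j) * X ^ Fintype.card F ^ j := by
  induction l with
  | zero => simp [addPoly, addCoeff]
  | succ l ih =>
    have h := map_sum (FiniteField.frobeniusAlgHom F A[X])
      (fun j => C (addCoeff F c m l j) * X ^ Fintype.card F ^ j) (Finset.range (l + 1))
    simp only [FiniteField.frobeniusAlgHom_apply] at h
    have h' : addPoly F c m l = ∑ j ∈ Finset.range (l + 2),
        C (addCoeff F c m l j) * X ^ Fintype.card F ^ j := by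
      rw [Finset.sum_range_succ, ← ih, addCoeff_eq_zero F c m (Nat.lt_succ_self l)]; simp
    rw [addPoly]
    conv_lhs => enter [2]; rw [h']
    rw [ih, h, Finset.sum_range_succ' _ (l + 1), Finset.sum_range_succ' _ (l + 1), mul_add,
      Finset.mul_sum, ← sub_sub, ← Finset.sum_sub_distrib]
    simp only [addCoeff, C_sub, C_neg, C_mul, C_pow, mul_pow, pow_succ, pow_mul]
    rw [sub_eq_add_neg]
    congr 1
    · refine Finset.sum_congr rfl fun j _ => ?_
      ring
    · ring

omit [Algebra F A] in
theorem addPoly_monic [Nontrivial A] (c : ℕ → A) (m l : ℕ) :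
    (addPoly F c m l).Monic ∧ (addPoly F c m l).natDegree = Fintype.card F ^ l := by
  induction l with
  | zero => simp [addPoly, monic_X]
  | succ l ih =>
    have hq := Fintype.one_lt_card (α := F)
    have hm : (addPoly F c m l ^ Fintype.card F).Monic := ih.1.pow _
    have hd : (addPoly F c m l ^ Fintype.card F).natDegree = Fintype.card F ^ (l + 1) := by
      rw [ih.1.natDegree_pow, ih.2, pow_succ, mul_comm]
    have hlt : (C (c (m + l)) * addPoly F c m l).natDegree <
        (addPoly F c m l ^ Fintype.card F).natDegree := by
      rw [hd]
      refine (natDegree_C_mul_le _ _).trans_lt ?_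
      rw [ih.2]
      exact Nat.pow_lt_pow_right hq (Nat.lt_succ_self l)
    rw [addPoly]
    exact ⟨hm.sub_of_left (degree_lt_degree hlt), by
      rw [natDegree_sub_eq_left_of_natDegree_lt hlt, hd]⟩

/-- The roots of the polynomial attached to the first `m` members of a sequence: their span. -/
theorem addPoly_flagCoeff_eq_prod [IsDomain A] (x : ℕ → A) (m : ℕ) :
    addPoly F (flagCoeff F x) 0 m = ∏ u : Fin m → F, (X - C (∑ i, u i • x i)) := by
  induction m with
  | zero => simp [addPoly]
  | succ m ih =>
    set D := addPoly F (flagCoeff F x) 0 m with hD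
    have h1 := prod_sub_smul F D (C (D.eval (x m)))
    rw [addPoly, ← hD, zero_add, flagCoeff_eq, ← hD, C_pow, ← h1,
      ← (Fin.snocEquiv (fun _ : Fin (m + 1) => F)).prod_comp, Fintype.prod_prod_type]
    refine Finset.prod_congr rfl fun r _ => ?_
    rw [smul_C, ← addPoly_eval_smul, ← addPoly_comp_X_sub_C, ← hD, ih, prod_comp]
    refine Finset.prod_congr rfl fun u _ => ?_
    rw [sub_comp, X_comp, C_comp, sub_sub, ← C_add, Fin.sum_univ_castSucc]
    simp [Fin.snocEquiv, add_comm]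

end FlagPolynomials

/-! ### The action on polynomials -/

section Action

open MvPolynomial

variable {F : Type*} [Field F] {n : ℕ}

/-- The linear form with a given vector of coefficients. -/
def linForm : (Fin n → F) →ₗ[F] MvPolynomial (Fin n) F :=
  Fintype.linearCombination F X

theorem linForm_apply (v : Fin n → F) : linForm v = ∑ a, v a • (X a : MvPolynomial (Fin n) F) :=
  Fintype.linearCombination_apply F _ _

@[simp]
theorem linForm_single (b : Fin n) :
    linForm (Pi.single b 1) = (X b : MvPolynomial (Fin n) F) := by
  simp [linForm_apply, Pi.single_apply]

theorem coeff_linForm (v : Fin n → F) (b : Fin n) :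
    coeff (Finsupp.single b 1) (linForm v) = v b := by
  simp [linForm_apply, coeff_sum, coeff_X, Finsupp.single_left_inj]

theorem linForm_injective : Function.Injective (linForm : (Fin n → F) →ₗ[F] _) := by
  intro v w h
  ext b
  rw [← coeff_linForm v, h, coeff_linForm]

/-- The action of a matrix on polynomials by linear substitutions, extending its action on column
vectors, which are regarded as linear forms. -/
def act (g : Matrix (Fin n) (Fin n) F) : MvPolynomial (Fin n) F →ₐ[F] MvPolynomial (Fin n) F :=
  aeval fun b => linForm (g.col b)

theorem act_X (g : Matrix (Fin n) (Fin n) F) (b : Fin n) : act g (X b) = linForm (g.col b) := by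
  simp [act]

theorem act_linForm (g : Matrix (Fin n) (Fin n) F) (v : Fin n → F) :
    act g (linForm v) = linForm (g.mulVec v) := by
  simp only [linForm_apply, map_sum, map_smul, act_X, Matrix.col_apply, Matrix.mulVec, dotProduct,
    Finset.smul_sum, Finset.sum_smul, smul_smul]
  rw [Finset.sum_comm]
  simp only [mul_comm]

theorem act_one : act (1 : Matrix (Fin n) (Fin n) F) = AlgHom.id F _ := by
  apply MvPolynomial.algHom_ext
  intro b
  rw [← linForm_single, act_linForm, Matrix.one_mulVec]
  rfl

theorem act_mul (g h : Matrix (Fin n) (Fin n) F) : act (g * h) = (act g).comp (act h) := by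
  apply MvPolynomial.algHom_ext
  intro b
  rw [← linForm_single, AlgHom.comp_apply, act_linForm, act_linForm, act_linForm,
    Matrix.mulVec_mulVec]

/-- The action of an invertible matrix, as an automorphism. -/
def actEquiv (g : Matrix.GeneralLinearGroup (Fin n) F) :
    MvPolynomial (Fin n) F ≃ₐ[F] MvPolynomial (Fin n) F :=
  AlgEquiv.ofAlgHom (act (g : Matrix (Fin n) (Fin n) F))
    (act ((g⁻¹ : Matrix.GeneralLinearGroup (Fin n) F) : Matrix (Fin n) (Fin n) F))
    (by rw [← act_mul, ← Units.val_mul, mul_inv_cancel, Units.val_one, act_one])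
    (by rw [← act_mul, ← Units.val_mul, inv_mul_cancel, Units.val_one, act_one])

@[simp]
theorem actEquiv_apply (g : Matrix.GeneralLinearGroup (Fin n) F) (f : MvPolynomial (Fin n) F) :
    actEquiv g f = act (g : Matrix (Fin n) (Fin n) F) f := rfl

/-- The polynomials `f` with `(det g) ^ k • g f = f` for all `g` in the parabolic subgroup: the
invariants of `S(V) ⊗ Det ^ k`. -/
def semiInv (I : Composition n) (k : ℕ) : Submodule F (MvPolynomial (Fin n) F) where
  carrier := {f | ∀ g ∈ parabolic F I, (g : Matrix (Fin n) (Fin n) F).det ^ k • act g.1 f = f}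
  zero_mem' g _ := by simp
  add_mem' hf hf' g hg := by rw [map_add, smul_add, hf g hg, hf' g hg]
  smul_mem' r f hf g hg := by rw [map_smul, smul_comm, hf g hg]

theorem index_mono (I : Composition n) : Monotone I.index := by
  intro j k hjk
  by_contra! h
  have h1 := I.lt_sizeUpTo_index_succ k
  have h2 := I.sizeUpTo_index_le j
  have h3 := I.monotone_sizeUpTo (show ((I.index k).succ : ℕ) ≤ I.index j from h)
  have h4 : (j : ℕ) ≤ k := hjk
  omega

/-- Replacing the column `b` of the unit matrix by a vector that vanishes below its entry in row
`b` gives an upper triangular matrix. -/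
theorem updateCol_mem_parabolic (I : Composition n) {b : Fin n} {v : Fin n → F}
    (hv : ∀ c, b < c → v c = 0) (hb : v b ≠ 0) :
    ∃ g ∈ parabolic F I, (g : Matrix (Fin n) (Fin n) F) = Matrix.updateCol 1 b v ∧
      (g : Matrix (Fin n) (Fin n) F).det = v b := by
  have htri : ∀ i j, j < i → (Matrix.updateCol 1 b v : Matrix (Fin n) (Fin n) F) i j = 0 := by
    intro i j hij
    rw [Matrix.updateCol_apply]
    split_ifs with h
    · exact hv _ (h ▸ hij)
    · exact Matrix.one_apply_ne hij.ne'
  have hdet : (Matrix.updateCol 1 b v : Matrix (Fin n) (Fin n) F).det = v b := by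
    rw [Matrix.det_of_isUpperTriangular fun i j hij => htri i j hij, Finset.prod_eq_single b]
    · simp
    · intro c _ hc
      rw [Matrix.updateCol_ne hc, Matrix.one_apply_eq]
    · simp
  refine ⟨Matrix.GeneralLinearGroup.mkOfDetNeZero _ (hdet ▸ hb), ?_, rfl, hdet⟩
  intro i j hij
  exact htri i j (lt_of_not_ge fun h => absurd (index_mono I h) (not_le.2 hij))

theorem updateCol_one_mulVec (b : Fin n) (v w : Fin n → F) :
    (Matrix.updateCol 1 b v).mulVec w = w + w b • (v - Pi.single b 1) := by
  ext a
  simp only [Matrix.mulVec, dotProduct, Matrix.updateCol_apply, Pi.add_apply, Pi.smul_apply,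
    Pi.sub_apply, smul_eq_mul]
  rw [← Finset.add_sum_erase _ _ (Finset.mem_univ b)]
  have h : ∑ x ∈ Finset.univ.erase b, (if x = b then v a else (1 : Matrix _ _ F) a x) * w x =
      ∑ x ∈ Finset.univ.erase b, (1 : Matrix _ _ F) a x * w x :=
    Finset.sum_congr rfl fun x hx => by rw [if_neg (Finset.ne_of_mem_erase hx)]
  have h2 : ∑ x, (1 : Matrix _ _ F) a x * w x = w a := by
    simp [Matrix.one_apply]
  rw [← Finset.add_sum_erase _ _ (Finset.mem_univ b)] at h2
  rw [h, if_pos rfl, eq_sub_of_add_eq' h2, Matrix.one_apply, Pi.single_apply]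
  ring

/-- A polynomial with a nontrivial character is divisible by each linear form with leading
coefficient `1`: some reflections in the parabolic subgroup multiply the form by a scalar and act
trivially modulo it. -/
theorem linForm_dvd_of_mem_semiInv [Fintype F] {I : Composition n} {k : ℕ}
    (hk : ¬ Fintype.card F - 1 ∣ k) {f : MvPolynomial (Fin n) F} (hf : f ∈ semiInv I k)
    {b : Fin n} {v : Fin n → F} (hv : ∀ c, b < c → v c = 0) (hb : v b = 1) :
    linForm v ∣ f := by
  rw [← FiniteField.forall_pow_eq_one_iff F] at hk
  push Not at hk
  obtain ⟨r, hr⟩ := hk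
  obtain ⟨g, hg, hgM, hgdet⟩ := updateCol_mem_parabolic I (b := b)
    (v := Pi.single b 1 + ((r : F) - 1) • v)
    (by intro c hc; simp [hv c hc, hc.ne']) (by simp [hb])
  have hdet : (g : Matrix (Fin n) (Fin n) F).det = r := by rw [hgdet]; simp [hb]
  let π := Ideal.Quotient.mkₐ F (Ideal.span {linForm v})
  have hact : π.comp (act g.1) = π := by
    apply MvPolynomial.algHom_ext
    intro c
    rw [AlgHom.comp_apply, ← linForm_single, act_linForm, hgM, updateCol_one_mulVec, map_add,
      map_add, add_sub_cancel_left, map_smul, map_smul, map_smul, map_smul]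
    have : π (linForm v) = 0 := Ideal.Quotient.eq_zero_iff_mem.2 (Ideal.mem_span_singleton_self _)
    rw [this, smul_zero, smul_zero, add_zero]
  have h1 : π ((r : F) ^ k • f) = π f := by
    conv_rhs => rw [← hf g hg, hdet, map_smul]
    rw [map_smul, ← AlgHom.comp_apply, hact]
  rw [map_smul] at h1
  have h2 : ((r : F) ^ k - 1) • π f = 0 := by rw [sub_smul, h1, one_smul, sub_self]
  have h3 : (r : F) ^ k - 1 ≠ 0 := by
    intro h
    apply hr
    ext
    rw [Units.val_pow_eq_pow_val, Units.val_one, sub_eq_zero.1 h]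
  have h4 := (smul_eq_zero_iff_right h3).1 h2
  exact Ideal.mem_span_singleton.1 (Ideal.Quotient.eq_zero_iff_mem.1 h4)

end Action

/-! ### The Moore determinant -/

section Moore

open MvPolynomial

variable (F : Type*) [Field F] (n : ℕ)

/-- The variables, as a sequence. -/
def vars (a : ℕ) : MvPolynomial (Fin n) F := if h : a < n then X ⟨a, h⟩ else 0

variable {n} in
theorem vars_val (a : Fin n) : vars F n a = X a := by simp [vars]

variable {F}

/-- Extension of a vector by zero. -/
def extendVec {m : ℕ} (u : Fin m → F) : Fin n → F :=
  fun a => if h : (a : ℕ) < m then u ⟨a, h⟩ else 0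

theorem extendVec_of_le {m : ℕ} (u : Fin m → F) {a : Fin n} (h : m ≤ a) : extendVec n u a = 0 :=
  dif_neg (not_lt.2 h)

theorem linForm_extendVec {m : ℕ} (hm : m ≤ n) (u : Fin m → F) :
    linForm (extendVec n u) = ∑ i, u i • vars F n i := by
  set f : ℕ → MvPolynomial (Fin n) F := fun a => (if h : a < m then u ⟨a, h⟩ else 0) • vars F n a
    with hf
  have h1 : linForm (extendVec n u) = ∑ a ∈ Finset.range n, f a := by
    rw [linForm_apply, ← Fin.sum_univ_eq_sum_range]
    exact Finset.sum_congr rfl fun a _ => by rw [hf, ← vars_val]; rfl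
  have h2 : ∑ i, u i • vars F n i = ∑ a ∈ Finset.range m, f a := by
    rw [← Fin.sum_univ_eq_sum_range]
    exact Finset.sum_congr rfl fun a _ => by simp [hf]
  rw [h1, h2]
  refine (Finset.sum_subset (by simpa using hm) fun a _ ha => ?_).symm
  rw [Finset.mem_range] at ha
  simp [hf, ha]

variable (F) [Fintype F]

/-- The Moore matrix, with rows the Frobenius powers of the variables. -/
def moore : Matrix (Fin n) (Fin n) (MvPolynomial (Fin n) F) :=
  Matrix.of fun i a => X a ^ Fintype.card F ^ (i : ℕ)

theorem linForm_pow (v : Fin n → F) (i : ℕ) :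
    linForm v ^ Fintype.card F ^ i =
      ∑ a, v a • (X a : MvPolynomial (Fin n) F) ^ Fintype.card F ^ i := by
  have h : ∀ x : MvPolynomial (Fin n) F,
      (FiniteField.frobeniusAlgHom F (MvPolynomial (Fin n) F) ^ i) x = x ^ Fintype.card F ^ i := by
    intro x
    rw [AlgHom.coe_pow, FiniteField.coe_frobeniusAlgHom, pow_iterate]
  rw [← h, linForm_apply, map_sum]
  exact Finset.sum_congr rfl fun a _ => by rw [map_smul, h]

theorem mapMatrix_act_moore (g : Matrix (Fin n) (Fin n) F) :
    (act g).mapMatrix (moore F n) = moore F n * g.map C := by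
  ext1 i b
  rw [AlgHom.mapMatrix_apply, Matrix.map_apply, Matrix.mul_apply]
  simp only [moore, Matrix.of_apply, Matrix.map_apply, map_pow, act_X, linForm_pow,
    Matrix.col_apply, smul_eq_C_mul, mul_comm]

theorem act_det_moore (g : Matrix (Fin n) (Fin n) F) :
    act g (moore F n).det = g.det • (moore F n).det := by
  have h : (g.map (C : F →+* MvPolynomial (Fin n) F)).det = C g.det := by
    rw [RingHom.map_det]; rfl
  rw [AlgHom.map_det, mapMatrix_act_moore, Matrix.det_mul, h, smul_eq_C_mul, mul_comm]

omit [Fintype F] in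
/-- A determinant is homogeneous when the degrees of its entries depend on the row only. -/
theorem isHomogeneous_det {m : ℕ} {M : Matrix (Fin m) (Fin m) (MvPolynomial (Fin n) F)}
    {d : Fin m → ℕ}
    (h : ∀ i j, (M i j).IsHomogeneous (d i)) : M.det.IsHomogeneous (∑ i, d i) := by
  rw [Matrix.det_apply]
  refine IsHomogeneous.sum _ _ _ fun σ _ => ?_
  rw [← Equiv.sum_comp σ d]
  have := IsHomogeneous.prod Finset.univ (fun i => M (σ i) i) _ fun i _ => h (σ i) i
  rcases Int.units_eq_one_or (Equiv.Perm.sign σ) with hs | hs <;> rw [hs]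
  · rwa [one_smul]
  · rw [Units.neg_smul, one_smul]
    exact this.neg

theorem isHomogeneous_moore (i a : Fin n) :
    (moore F n i a).IsHomogeneous (Fintype.card F ^ (i : ℕ)) := by
  simpa [moore] using isHomogeneous_X_pow (R := F) a (Fintype.card F ^ (i : ℕ))

theorem eval_addPoly_vars {m : ℕ} (hm : m ≤ n) (y : MvPolynomial (Fin n) F) :
    (addPoly F (flagCoeff F (vars F n)) 0 m).eval y =
      ∏ u : Fin m → F, (y - linForm (extendVec n u)) := by
  rw [addPoly_flagCoeff_eq_prod, Polynomial.eval_prod]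
  exact Finset.prod_congr rfl fun u _ => by
    rw [linForm_extendVec n hm, Polynomial.eval_sub, Polynomial.eval_X, Polynomial.eval_C]

/-- Row operations with the coefficients of the additive polynomials of the flag make the Moore
matrix triangular. -/
theorem det_moore :
    (moore F n).det = ∏ b : Fin n, ∏ u : Fin b → F, (X b - linForm (extendVec n u)) := by
  set c := flagCoeff F (vars F n) with hc
  let U : Matrix (Fin n) (Fin n) (MvPolynomial (Fin n) F) :=
    Matrix.of fun i j => addCoeff F c 0 i j
  have hU : U.det = 1 := by
    rw [Matrix.det_of_isLowerTriangular]
    · exact Finset.prod_eq_one fun i _ => addCoeff_self F c 0 i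
    · intro i j hij
      exact addCoeff_eq_zero F c 0 hij
  have hUM : ∀ i a, (U * moore F n) i a = (addPoly F c 0 i).eval (X a) := by
    intro i a
    rw [Matrix.mul_apply, addPoly_eq_sum, Polynomial.eval_finsetSum]
    simp only [U, moore, Matrix.of_apply, Polynomial.eval_mul, Polynomial.eval_C,
      Polynomial.eval_pow, Polynomial.eval_X]
    rw [Fin.sum_univ_eq_sum_range
      (fun j => addCoeff F c 0 i j * (X a : MvPolynomial (Fin n) F) ^ Fintype.card F ^ j) n]
    symm
    refine Finset.sum_subset (by simp) fun j _ hj => ?_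
    rw [Finset.mem_range, not_lt] at hj
    rw [addCoeff_eq_zero F c 0 (by omega), zero_mul]
  have h : (U * moore F n).det = (moore F n).det := by rw [Matrix.det_mul, hU, one_mul]
  rw [← h, Matrix.det_of_isUpperTriangular]
  · exact Finset.prod_congr rfl fun b _ => by rw [hUM, hc, eval_addPoly_vars F n b.2.le]
  · intro i a hia
    rw [hUM, hc, eval_addPoly_vars F n i.2.le]
    refine Finset.prod_eq_zero (Finset.mem_univ (Pi.single ⟨a, hia⟩ 1)) ?_
    rw [linForm_extendVec n i.2.le]
    simp [Pi.single_apply, vars_val]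

variable {F}

/-- The vector with entry `1` in row `b`, zero entries below it, and the entries `-u` above. -/
def rootVec (b : Fin n) (u : Fin b → F) : Fin n → F := Pi.single b 1 - extendVec n u

omit [Fintype F] in
theorem rootVec_self (b : Fin n) (u : Fin b → F) : rootVec n b u b = 1 := by
  simp [rootVec, extendVec_of_le]

omit [Fintype F] in
theorem rootVec_of_lt {b c : Fin n} (u : Fin b → F) (h : b < c) : rootVec n b u c = 0 := by
  simp [rootVec, extendVec_of_le n u h.le, h.ne']

omit [Fintype F] in
theorem rootVec_injective (b : Fin n) : Function.Injective (rootVec (F := F) n b) := by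
  intro u w h
  ext i
  have := congrFun (sub_right_injective h) ⟨i, i.2.trans b.2⟩
  simpa [extendVec] using this

omit [Fintype F] in
theorem prime_linForm_rootVec (b : Fin n) (u : Fin b → F) : Prime (linForm (rootVec n b u)) := by
  obtain ⟨g, -, hg, -⟩ := updateCol_mem_parabolic (Composition.ones n)
    (fun c hc => rootVec_of_lt n u hc) (by rw [rootVec_self]; exact one_ne_zero)
  have h : linForm (rootVec n b u) = actEquiv g (X b) := by
    rw [actEquiv_apply, ← linForm_single, act_linForm, hg, updateCol_one_mulVec]
    simp
  rw [h, MulEquiv.prime_iff]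
  exact X_prime

omit [Fintype F] in
theorem not_rootVec_dvd {b c : Fin n} (hcb : c ≤ b) (u : Fin b → F) (w : Fin c → F)
    (hne : (⟨b, u⟩ : Σ b : Fin n, (Fin b → F)) ≠ ⟨c, w⟩) :
    ¬ linForm (rootVec n b u) ∣ linForm (rootVec n c w) := by
  rintro ⟨r, hr⟩
  -- the substitution `X b ↦ linForm (extendVec n u)` kills the first form, but not the second
  set M : Matrix (Fin n) (Fin n) F := Matrix.updateCol 1 b (extendVec n u)
  have h0 : M.mulVec (rootVec n b u) = 0 := by
    rw [updateCol_one_mulVec, rootVec_self, rootVec]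
    simp
  have h1 := congrArg (act M) hr
  rw [map_mul, act_linForm, act_linForm, h0, map_zero, zero_mul] at h1
  have h2 := linForm_injective (h1.trans (map_zero _).symm)
  rw [updateCol_one_mulVec] at h2
  rcases hcb.lt_or_eq with h | rfl
  · have h3 := congrFun h2 c
    rw [rootVec_of_lt n w h, zero_smul, add_zero, rootVec_self] at h3
    exact one_ne_zero h3
  · apply hne
    rw [rootVec_self, one_smul, ← neg_sub (Pi.single c 1), ← rootVec, ← sub_eq_add_neg,
      sub_eq_zero] at h2
    rw [rootVec_injective n c h2]

variable {n}

theorem det_moore_dvd {I : Composition n} {k : ℕ} (hk : ¬ Fintype.card F - 1 ∣ k)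
    {f : MvPolynomial (Fin n) F} (hf : f ∈ semiInv I k) : (moore F n).det ∣ f := by
  have h : (moore F n).det =
      ∏ p : Σ b : Fin n, (Fin b → F), linForm (rootVec n p.1 p.2) := by
    rw [det_moore, Fintype.prod_sigma]
    simp [rootVec]
  rw [h]
  refine Fintype.prod_dvd_of_isRelPrime ?_ fun p => linForm_dvd_of_mem_semiInv hk hf
    (fun c hc => rootVec_of_lt n p.2 hc) (rootVec_self n p.1 p.2)
  rintro ⟨b, u⟩ ⟨c, w⟩ hne
  rcases le_total c b with h | h
  · exact (prime_linForm_rootVec n b u).irreducible.isRelPrime_iff_not_dvd.2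
      (not_rootVec_dvd n h u w hne)
  · exact ((prime_linForm_rootVec n c w).irreducible.isRelPrime_iff_not_dvd.2
      (not_rootVec_dvd n h w u hne.symm)).symm

variable (F n) in
theorem det_moore_ne_zero : (moore F n).det ≠ 0 := by
  rw [det_moore]
  refine Finset.prod_ne_zero_iff.2 fun b _ => Finset.prod_ne_zero_iff.2 fun u _ => ?_
  have := (prime_linForm_rootVec n b u).ne_zero
  simpa [rootVec] using this

theorem det_moore_mul_mem_semiInv_iff {I : Composition n} {k : ℕ} {f : MvPolynomial (Fin n) F} :
    (moore F n).det * f ∈ semiInv I k ↔ f ∈ semiInv I (k + 1) := by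
  refine forall₂_congr fun g _ => ?_
  rw [map_mul, act_det_moore, smul_mul_assoc, smul_smul, ← pow_succ, ← mul_smul_comm,
    mul_right_inj' (det_moore_ne_zero F n)]

theorem semiInv_add_card_sub_one (I : Composition n) :
    semiInv (F := F) I (Fintype.card F - 1) = semiInv I 0 := by
  ext f
  refine forall₂_congr fun g _ => ?_
  rw [FiniteField.pow_card_sub_one_eq_one _ (Matrix.GeneralLinearGroup.det_ne_zero g), pow_zero]

/-- For a nontrivial power of the determinant, the semi-invariants are the multiples of a power of
the Moore determinant by the invariants. -/
theorem mem_semiInv_iff {I : Composition n} {k e : ℕ} (hk : 1 ≤ k)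
    (he : k + e = Fintype.card F - 1) {f : MvPolynomial (Fin n) F} :
    f ∈ semiInv I k ↔ ∃ h ∈ semiInv I 0, f = (moore F n).det ^ e * h := by
  induction e generalizing k f with
  | zero =>
    rw [add_zero] at he
    rw [he, semiInv_add_card_sub_one]
    simp
  | succ e ih =>
    have ih' := @ih (k + 1) (by omega) (by omega)
    constructor
    · intro hf
      obtain ⟨f', rfl⟩ := det_moore_dvd (Nat.not_dvd_of_pos_of_lt hk (by omega)) hf
      obtain ⟨h, hh, rfl⟩ := ih'.1 (det_moore_mul_mem_semiInv_iff.1 hf)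
      exact ⟨h, hh, by rw [pow_succ', mul_assoc]⟩
    · rintro ⟨h, hh, rfl⟩
      rw [pow_succ', mul_assoc, det_moore_mul_mem_semiInv_iff, ih']
      exact ⟨h, hh, rfl⟩

end Moore

/-! ### Generators of the ring of invariants of a parabolic subgroup -/

section Generators

open Polynomial

variable {F : Type*} [Field F] [Fintype F] {n : ℕ}

/-- The monic polynomial with roots the linear forms in the first `m` variables. -/
theorem addPoly_vars_eq_prod [DecidableEq F] {m : ℕ} (hm : m ≤ n) :
    addPoly F (flagCoeff F (vars F n)) 0 m =
      ∏ v : Fin n → F with ∀ a : Fin n, m ≤ a → v a = 0, (X - C (linForm v)) := by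
  rw [addPoly_flagCoeff_eq_prod]
  refine Finset.prod_bij (fun u _ => extendVec n u) (fun u _ => ?_) (fun u _ w _ h => ?_)
    (fun v hv => ?_) (fun u _ => ?_)
  · simpa using fun a h => extendVec_of_le n u h
  · ext i
    simpa [extendVec] using congrFun h ⟨i, i.2.trans_le hm⟩
  · refine ⟨fun i => v ⟨i, i.2.trans_le hm⟩, Finset.mem_univ _, ?_⟩
    ext a
    rw [Finset.mem_filter] at hv
    by_cases h : (a : ℕ) < m
    · simp [extendVec, h]
    · simp [extendVec, h, hv.2 a (not_lt.1 h)]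
  · rw [linForm_extendVec n hm]

omit [Fintype F] in
theorem mulVec_vanish {I : Composition n} {g : Matrix.GeneralLinearGroup (Fin n) F}
    (hg : g ∈ parabolic F I) (i : ℕ) {v : Fin n → F}
    (hv : ∀ a : Fin n, I.sizeUpTo i ≤ a → v a = 0) (a : Fin n) (ha : I.sizeUpTo i ≤ a) :
    (g : Matrix (Fin n) (Fin n) F).mulVec v a = 0 := by
  rw [Matrix.mulVec, dotProduct]
  refine Finset.sum_eq_zero fun b _ => ?_
  by_cases hb : I.sizeUpTo i ≤ b
  · rw [hv b hb, mul_zero]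
  · have hgab : (g : Matrix (Fin n) (Fin n) F) a b = 0 := by
      refine hg (lt_of_not_ge fun h => ?_)
      have h1 := I.lt_sizeUpTo_index_succ a
      have h2 := I.sizeUpTo_index_le b
      have h5 : (I.index b : ℕ) < i := by
        by_contra! h6
        have := I.monotone_sizeUpTo h6
        omega
      have h3 : ((I.index a).succ : ℕ) ≤ i := by
        have : (I.index a : ℕ) ≤ I.index b := h
        simp only [Fin.val_succ]
        omega
      have h4 := I.monotone_sizeUpTo h3
      omega
    rw [hgab, zero_mul]

/-- The members of the flag that are stable under the parabolic subgroup have invariant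
polynomials. -/
theorem map_act_addPoly_sizeUpTo {I : Composition n} {g : Matrix.GeneralLinearGroup (Fin n) F}
    (hg : g ∈ parabolic F I) (i : ℕ) :
    (addPoly F (flagCoeff F (vars F n)) 0 (I.sizeUpTo i)).map (act g.1 : _ →+* _) =
      addPoly F (flagCoeff F (vars F n)) 0 (I.sizeUpTo i) := by
  classical
  rw [addPoly_vars_eq_prod (I.sizeUpTo_le i), Polynomial.map_prod]
  refine Finset.prod_bij' (fun v _ => g.1.mulVec v) (fun v _ => g⁻¹.1.mulVec v) (fun v hv => ?_)
    (fun v hv => ?_) (fun v _ => ?_) (fun v _ => ?_) (fun v _ => ?_)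
  · simp only [Finset.mem_filter, Finset.mem_univ, true_and] at hv ⊢
    exact mulVec_vanish hg i hv
  · simp only [Finset.mem_filter, Finset.mem_univ, true_and] at hv ⊢
    exact mulVec_vanish (inv_mem hg) i hv
  · rw [Matrix.mulVec_mulVec, ← Units.val_mul, inv_mul_cancel, Units.val_one, Matrix.one_mulVec]
  · rw [Matrix.mulVec_mulVec, ← Units.val_mul, mul_inv_cancel, Units.val_one, Matrix.one_mulVec]
  · rw [Polynomial.map_sub, map_X, map_C, RingHom.coe_coe, act_linForm]

variable (F) in
/-- The generator with index `(i, j)` of the ring of invariants of a parabolic subgroup: a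
coefficient of the additive polynomial that turns the polynomial of the `i`-th member of the flag
into that of the next one, that is, a Dickson invariant of the `i`-th block. -/
def parGen (I : Composition n) (p : Σ i : Fin I.length, Fin (I.blocksFun i)) :
    MvPolynomial (Fin n) F :=
  addCoeff F (flagCoeff F (vars F n)) (I.sizeUpTo p.1) (I.blocksFun p.1) p.2

/-- The degree of a generator of the ring of invariants. -/
def parDeg (q : ℕ) (I : Composition n) (p : Σ i : Fin I.length, Fin (I.blocksFun i)) : ℕ :=
  q ^ I.sizeUpTo (p.1 + 1) - q ^ (I.sizeUpTo p.1 + p.2)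

theorem coeff_addPoly {A : Type*} [CommRing A] [Algebra F A] (c : ℕ → A) (m l j : ℕ) (hj : j ≤ l) :
    (addPoly F c m l).coeff (Fintype.card F ^ j) = addCoeff F c m l j := by
  rw [addPoly_eq_sum, finsetSum_coeff, Finset.sum_eq_single j]
  · simp
  · intro i _ hij
    have h := (Nat.pow_right_injective (Fintype.one_lt_card (α := F))).ne hij.symm
    rw [coeff_C_mul, coeff_X_pow, if_neg h, mul_zero]
  · intro h
    exact absurd (Finset.mem_range.2 (Nat.lt_succ_of_le hj)) h

theorem comp_left_injective {A : Type*} [CommRing A] [IsDomain A] {p q r : A[X]}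
    (hr : 0 < r.natDegree) (h : p.comp r = q.comp r) : p = q := by
  have h1 : (p - q).comp r = 0 := by rw [sub_comp, h, sub_self]
  rcases comp_eq_zero_iff.1 h1 with h2 | ⟨-, h2⟩
  · exact sub_eq_zero.1 h2
  · rw [h2, natDegree_C] at hr
    exact absurd hr (lt_irrefl _)

theorem act_parGen {I : Composition n} {g : Matrix.GeneralLinearGroup (Fin n) F}
    (hg : g ∈ parabolic F I) (p : Σ i : Fin I.length, Fin (I.blocksFun i)) :
    act g.1 (parGen F I p) = parGen F I p := by
  set c := flagCoeff F (vars F n) with hc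
  set m := I.sizeUpTo p.1 with hm
  set l := I.blocksFun p.1 with hl
  have h1 : (addPoly F c m l).map (act g.1 : _ →+* _) = addPoly F c m l := by
    have h2 := map_act_addPoly_sizeUpTo hg ((p.1 : ℕ) + 1)
    rw [I.sizeUpTo_succ', ← hc, ← hm, ← hl, ← addPoly_comp, Polynomial.map_comp, hm,
      map_act_addPoly_sizeUpTo hg, ← hm] at h2
    refine comp_left_injective ?_ h2
    rw [(addPoly_monic F c 0 m).2]
    exact pow_pos Fintype.card_pos _
  have h3 := congrArg (fun r => r.coeff (Fintype.card F ^ (p.2 : ℕ))) h1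
  simp only [coeff_map, coeff_addPoly c m l _ p.2.2.le] at h3
  exact h3

theorem isHomogeneous_eval_addPoly (m : ℕ) :
    ((addPoly F (flagCoeff F (vars F n)) 0 m).eval (vars F n m)).IsHomogeneous
      (Fintype.card F ^ m) := by
  have hv : ∀ a, (vars F n a).IsHomogeneous 1 := by
    intro a
    rw [vars]
    split_ifs
    · exact MvPolynomial.isHomogeneous_X _ _
    · exact MvPolynomial.isHomogeneous_zero _ _ _
  rw [addPoly_flagCoeff_eq_prod, eval_prod]
  have := MvPolynomial.IsHomogeneous.prod (R := F) (Finset.univ : Finset (Fin m → F))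
    (fun u => (X - C (∑ i, u i • vars F n i)).eval (vars F n m)) (fun _ => 1) fun u _ => by
      rw [eval_sub, eval_X, eval_C]
      refine (hv m).sub (MvPolynomial.IsHomogeneous.sum _ _ _ fun i _ => ?_)
      rw [MvPolynomial.smul_eq_C_mul]
      exact (hv i).C_mul _
  simpa using this

theorem isHomogeneous_addCoeff (m l j : ℕ) (hj : j ≤ l) :
    (addCoeff F (flagCoeff F (vars F n)) m l j).IsHomogeneous
      (Fintype.card F ^ (m + l) - Fintype.card F ^ (m + j)) := by
  set q := Fintype.card F with hq
  have hq0 : 1 < q := Fintype.one_lt_card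
  have hpow : ∀ a b, a ≤ b → q ^ a ≤ q ^ b := fun a b h => Nat.pow_le_pow_right (by omega) h
  induction l generalizing j with
  | zero =>
    obtain rfl : j = 0 := by omega
    simpa [addCoeff] using MvPolynomial.isHomogeneous_one (Fin n) F
  | succ l ih =>
    have hc : (flagCoeff F (vars F n) (m + l)).IsHomogeneous (q ^ (m + l + 1) - q ^ (m + l)) := by
      rw [flagCoeff_eq]
      have := (isHomogeneous_eval_addPoly (F := F) (n := n) (m + l)).pow (q - 1)
      rwa [← hq, Nat.mul_sub, mul_one, ← pow_succ] at this
    have hterm : ∀ j, (flagCoeff F (vars F n) (m + l) *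
        addCoeff F (flagCoeff F (vars F n)) m l j).IsHomogeneous
          (q ^ (m + l + 1) - q ^ (m + j)) := by
      intro j
      rcases le_or_gt j l with h | h
      · have := hc.mul (ih j h)
        have h1 := hpow (m + l) (m + l + 1) (by omega)
        have h2 := hpow (m + j) (m + l) (by omega)
        rwa [show q ^ (m + l + 1) - q ^ (m + l) + (q ^ (m + l) - q ^ (m + j)) =
          q ^ (m + l + 1) - q ^ (m + j) by omega] at this
      · rw [addCoeff_eq_zero F _ _ h, mul_zero]
        exact MvPolynomial.isHomogeneous_zero _ _ _
    cases j with
    | zero => exact (hterm 0).neg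
    | succ j =>
      refine MvPolynomial.IsHomogeneous.sub ?_ (hterm (j + 1))
      have := (ih j (by omega)).pow q
      rwa [Nat.sub_mul, ← pow_succ, ← pow_succ] at this

theorem isHomogeneous_parGen (I : Composition n) (p : Σ i : Fin I.length, Fin (I.blocksFun i)) :
    (parGen F I p).IsHomogeneous (parDeg (Fintype.card F) I p) := by
  rw [parDeg, I.sizeUpTo_succ']
  exact isHomogeneous_addCoeff _ _ _ p.2.2.le

variable (F) in
/-- The subring generated by the generators. -/
abbrev parRing (I : Composition n) : Subalgebra F (MvPolynomial (Fin n) F) :=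
  Algebra.adjoin F (Set.range (parGen F I))

theorem exists_lift_addPoly (I : Composition n) (i : ℕ) (hi : i ≤ I.length) :
    ∃ p : (parRing F I)[X], p.map (algebraMap (parRing F I) (MvPolynomial (Fin n) F)) =
      addPoly F (flagCoeff F (vars F n)) 0 (I.sizeUpTo i) := by
  induction i with
  | zero => exact ⟨X, by rw [map_X, I.sizeUpTo_zero, addPoly]⟩
  | succ i ih =>
    obtain ⟨p, hp⟩ := ih (by omega)
    let i' : Fin I.length := ⟨i, hi⟩
    have h : ∃ r : (parRing F I)[X], r.map (algebraMap (parRing F I) (MvPolynomial (Fin n) F)) =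
        addPoly F (flagCoeff F (vars F n)) (I.sizeUpTo i) (I.blocksFun i') := by
      refine ⟨X ^ Fintype.card F ^ I.blocksFun i' + ∑ j : Fin (I.blocksFun i'),
        C ⟨parGen F I ⟨i', j⟩, Algebra.subset_adjoin ⟨_, rfl⟩⟩ * X ^ Fintype.card F ^ (j : ℕ), ?_⟩
      rw [addPoly_eq_sum, Finset.sum_range_succ, addCoeff_self, C_1, one_mul, add_comm,
        ← Fin.sum_univ_eq_sum_range (fun j => C (addCoeff F (flagCoeff F (vars F n))
          (I.sizeUpTo i) (I.blocksFun i') j) * X ^ Fintype.card F ^ j) (I.blocksFun i')]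
      simp only [Polynomial.map_add, Polynomial.map_sum, Polynomial.map_mul, map_C,
        Polynomial.map_pow, map_X]
      rfl
    obtain ⟨r, hr⟩ := h
    refine ⟨r.comp p, ?_⟩
    rw [Polynomial.map_comp, hp, hr, addPoly_comp, I.sizeUpTo_succ' i']

end Generators

/-! ### The ring of invariants is generated by the generators -/

section Galois

open Polynomial

variable {F : Type*} [Field F] [Fintype F] {n : ℕ}

theorem parGen_mem_semiInv (I : Composition n) {f : MvPolynomial (Fin n) F}
    (hf : f ∈ parRing F I) : f ∈ semiInv I 0 := by
  intro g hg
  rw [pow_zero, one_smul]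
  induction hf using Algebra.adjoin_induction with
  | mem x hx =>
    obtain ⟨p, rfl⟩ := hx
    exact act_parGen hg p
  | algebraMap r => exact AlgHom.commutes _ _
  | add x y _ _ hx hy => rw [map_add, hx, hy]
  | mul x y _ _ hx hy => rw [map_mul, hx, hy]

variable (F) in
/-- The polynomial with roots all linear forms, with coefficients in the subring generated by
the generators. -/
theorem exists_lift_prod_linForm (I : Composition n) :
    ∃ p : (parRing F I)[X], p.map (algebraMap (parRing F I) (MvPolynomial (Fin n) F)) =
      ∏ v : Fin n → F, (X - C (linForm v)) := by
  classical
  obtain ⟨p, hp⟩ := exists_lift_addPoly (F := F) I I.length le_rfl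
  refine ⟨p, ?_⟩
  rw [hp, I.sizeUpTo_length, addPoly_vars_eq_prod le_rfl, Finset.filter_true_of_mem]
  exact fun v _ a ha => absurd a.2 (not_lt.2 ha)

instance (I : Composition n) : Algebra.IsIntegral (parRing F I) (MvPolynomial (Fin n) F) := by
  obtain ⟨p, hp⟩ := exists_lift_prod_linForm F I
  have hinj : Function.Injective (algebraMap (parRing F I) (MvPolynomial (Fin n) F)) :=
    Subtype.val_injective
  have hmon : p.Monic := by
    refine Polynomial.monic_of_injective hinj ?_
    rw [hp]
    exact monic_prod_X_sub_C _ _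
  refine ⟨fun f => ?_⟩
  induction f using MvPolynomial.induction_on with
  | C r => exact isIntegral_algebraMap (x := algebraMap F (parRing F I) r)
  | add f g hf hg => exact hf.add hg
  | mul_X f b hf =>
    refine hf.mul ⟨p, hmon, ?_⟩
    rw [← eval_map, hp, eval_prod]
    refine Finset.prod_eq_zero (Finset.mem_univ (Pi.single b 1)) ?_
    simp

theorem algebraicIndependent_parGen (I : Composition n) :
    AlgebraicIndependent F (parGen F I) := by
  refine (Algebra.IsAlgebraic.isTranscendenceBasis_of_lift_le_trdeg_of_finite F (parGen F I)
    ?_).1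
  rw [MvPolynomial.trdeg_of_isDomain, Cardinal.mk_congr I.blocksFinEquiv]
  simp

instance (I : Composition n) : IsIntegrallyClosed (parRing F I) :=
  IsIntegrallyClosed.of_equiv (algebraicIndependent_parGen I).aevalEquiv.toRingEquiv

/-- Let a domain `S` be integral over an integrally closed ring `R`, and generated by the roots of
a polynomial over `R` that is a product of distinct linear factors over `S`. By Galois theory for
the fields of fractions, an element of `S` fixed by the injective endomorphisms over `R` lies
in `R`. -/
theorem mem_range_algebraMap_of_fixed {R S ι : Type*} [CommRing R] [IsDomain R] [CommRing S]
    [IsDomain S] [Algebra R S] [IsIntegrallyClosed R] [Algebra.IsIntegral R S] [Fintype ι]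
    (hRS : Function.Injective (algebraMap R S)) {l : ι → S} (hl : Function.Injective l)
    (hgen : Algebra.adjoin R (Set.range l) = ⊤) {p : R[X]}
    (hp : p.map (algebraMap R S) = ∏ i, (X - C (l i))) {f : S}
    (hf : ∀ τ : S →ₐ[R] S, Function.Injective τ → τ f = f) :
    f ∈ Set.range (algebraMap R S) := by
  have : FaithfulSMul R S := (faithfulSMul_iff_algebraMap_injective R S).2 hRS
  let K := FractionRing S
  let φ : S →ₐ[R] K := IsScalarTower.toAlgHom R S K
  have hφ : Function.Injective φ := FaithfulSMul.algebraMap_injective S K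
  have : FaithfulSMul R K := (faithfulSMul_iff_algebraMap_injective R K).2 (by
    rw [IsScalarTower.algebraMap_eq R S K]
    exact hφ.comp hRS)
  let : Algebra (FractionRing R) K := FractionRing.liftAlgebra R K
  have : IsScalarTower R (FractionRing R) K := FractionRing.isScalarTower_liftAlgebra R K
  have hRK : (algebraMap (FractionRing R) K).comp (algebraMap R (FractionRing R)) =
      (algebraMap S K).comp (algebraMap R S) := by
    rw [← IsScalarTower.algebraMap_eq, ← IsScalarTower.algebraMap_eq]
  set P : (FractionRing R)[X] := p.map (algebraMap R (FractionRing R)) with hP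
  have hPK : P.map (algebraMap (FractionRing R) K) = ∏ i, (X - C (φ (l i))) := by
    rw [hP, Polynomial.map_map, hRK, ← Polynomial.map_map, hp, Polynomial.map_prod]
    refine Finset.prod_congr rfl fun i _ => ?_
    rw [Polynomial.map_sub, map_X, map_C]
    rfl
  have hPsep : P.Separable := by
    rw [← separable_map (algebraMap (FractionRing R) K), hPK, separable_prod_X_sub_C_iff]
    exact hφ.comp hl
  have hProot : ∀ y : K, aeval y P = 0 ↔ ∃ i, y = φ (l i) := by
    intro y
    rw [← eval_map_algebraMap, hPK, eval_prod, Finset.prod_eq_zero_iff]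
    simp [sub_eq_zero]
  have hsplit : P.IsSplittingField (FractionRing R) K := by
    rw [isSplittingField_iff_intermediateField]
    refine ⟨by rw [hPK]; exact Splits.prod fun _ _ => Splits.X_sub_C _, ?_⟩
    rw [eq_top_iff]
    have hS : ∀ s : S, φ s ∈ IntermediateField.adjoin (FractionRing R) (P.rootSet K) := by
      intro s
      have hs : s ∈ Algebra.adjoin R (Set.range l) := hgen ▸ Algebra.mem_top
      induction hs using Algebra.adjoin_induction with
      | mem x hx =>
        obtain ⟨i, rfl⟩ := hx
        refine IntermediateField.subset_adjoin _ _ ?_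
        rw [mem_rootSet']
        exact ⟨by rw [hPK]; exact (monic_prod_X_sub_C _ _).ne_zero, (hProot _).2 ⟨i, rfl⟩⟩
      | algebraMap r =>
        rw [AlgHom.commutes, IsScalarTower.algebraMap_apply R (FractionRing R) K]
        exact IntermediateField.algebraMap_mem _ _
      | add x y _ _ hx hy => rw [map_add]; exact add_mem hx hy
      | mul x y _ _ hx hy => rw [map_mul]; exact mul_mem hx hy
    intro z _
    obtain ⟨x, y, -, rfl⟩ := IsFractionRing.div_surjective S z
    exact div_mem (hS x) (hS y)
  have : IsGalois (FractionRing R) K := IsGalois.of_separable_splitting_field hPsep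
  have : FiniteDimensional (FractionRing R) K := IsSplittingField.finiteDimensional K P
  have hfix : φ f ∈ Set.range (algebraMap (FractionRing R) K) := by
    rw [IsGalois.mem_range_algebraMap_iff_fixed]
    intro σ
    let ψ : S →ₐ[R] K := ((σ : K →ₐ[FractionRing R] K).restrictScalars R).comp φ
    have hψ : ∀ s, ψ s ∈ φ.range := by
      intro s
      have hs : s ∈ Algebra.adjoin R (Set.range l) := hgen ▸ Algebra.mem_top
      induction hs using Algebra.adjoin_induction with
      | mem x hx =>
        obtain ⟨i, rfl⟩ := hx
        have h1 : aeval (σ (φ (l i))) P = 0 := by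
          rw [aeval_algHom_apply, (hProot _).2 ⟨i, rfl⟩, map_zero]
        obtain ⟨j, hj⟩ := (hProot _).1 h1
        exact ⟨l j, hj.symm⟩
      | algebraMap r => rw [AlgHom.commutes]; exact Subalgebra.algebraMap_mem _ _
      | add x y _ _ hx hy => rw [map_add]; exact add_mem hx hy
      | mul x y _ _ hx hy => rw [map_mul]; exact mul_mem hx hy
    let e := AlgEquiv.ofInjective φ hφ
    let τ : S →ₐ[R] S := (e.symm : φ.range →ₐ[R] S).comp (ψ.codRestrict φ.range hψ)
    have hτ : ∀ s, φ (τ s) = σ (φ s) := fun s =>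
      congrArg Subtype.val (e.apply_symm_apply (ψ.codRestrict φ.range hψ s))
    have hτinj : Function.Injective τ := by
      intro x y hxy
      have := congrArg φ hxy
      rw [hτ, hτ] at this
      exact hφ (σ.injective this)
    rw [← hτ, hf τ hτinj]
  obtain ⟨z, hz⟩ := hfix
  have hint : IsIntegral R z := by
    rw [← isIntegral_algebraMap_iff (A := FractionRing R) (B := K)
      (algebraMap (FractionRing R) K).injective, hz]
    exact (isIntegral_algebraMap_iff (A := S) (B := K) hφ).2 (Algebra.IsIntegral.isIntegral f)
  obtain ⟨r, rfl⟩ := IsIntegrallyClosed.isIntegral_iff.1 hint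
  exact ⟨r, hφ ((RingHom.congr_fun hRK r).symm.trans hz)⟩

/-- The injective endomorphisms of the polynomial ring over `parRing F I` permute the roots of the
polynomials of the members of the flag, so they are given by elements of the parabolic
subgroup. -/
theorem mem_parRing_of_mem_semiInv {I : Composition n} {f : MvPolynomial (Fin n) F}
    (hf : f ∈ semiInv I 0) : f ∈ parRing F I := by
  classical
  obtain ⟨p, hp⟩ := exists_lift_prod_linForm F I
  have hgen : Algebra.adjoin (parRing F I)
      (Set.range (linForm : (Fin n → F) → MvPolynomial (Fin n) F)) = ⊤ := by
    rw [eq_top_iff]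
    rintro s -
    induction s using MvPolynomial.induction_on with
    | C r => exact Subalgebra.algebraMap_mem _ (algebraMap F (parRing F I) r)
    | add f g hf hg => exact add_mem hf hg
    | mul_X f b hf =>
      rw [← linForm_single]
      exact mul_mem hf (Algebra.subset_adjoin ⟨_, rfl⟩)
  obtain ⟨r, rfl⟩ := mem_range_algebraMap_of_fixed (R := parRing F I) Subtype.val_injective
    linForm_injective hgen hp (f := f) fun τ hτ => by
      have hroot : ∀ b : Fin n, ∃ v : Fin n → F,
          (∀ a : Fin n, I.sizeUpTo ((I.index b : ℕ) + 1) ≤ a → v a = 0) ∧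
            τ (MvPolynomial.X b) = linForm v := by
        intro b
        obtain ⟨r, hr⟩ := exists_lift_addPoly (F := F) I ((I.index b : ℕ) + 1) (I.index b).2
        rw [addPoly_vars_eq_prod (I.sizeUpTo_le _)] at hr
        have h0 : ∀ y : MvPolynomial (Fin n) F, aeval y r =
            ∏ v : Fin n → F with ∀ a : Fin n, I.sizeUpTo ((I.index b : ℕ) + 1) ≤ a → v a = 0,
              (y - linForm v) := by
          intro y
          rw [← eval_map_algebraMap, hr, eval_prod]
          simp
        have h1 : aeval (MvPolynomial.X b : MvPolynomial (Fin n) F) r = 0 := by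
          rw [h0]
          refine Finset.prod_eq_zero (i := Pi.single b 1) ?_ (by simp)
          rw [Finset.mem_filter]
          refine ⟨Finset.mem_univ _, fun a ha => Pi.single_eq_of_ne ?_ _⟩
          rintro rfl
          exact absurd (I.lt_sizeUpTo_index_succ a) (not_lt.2 ha)
        have h2 : aeval (τ (MvPolynomial.X b)) r = 0 := by
          rw [aeval_algHom_apply, h1, map_zero]
        rw [h0, Finset.prod_eq_zero_iff] at h2
        obtain ⟨v, hv, h4⟩ := h2
        exact ⟨v, (Finset.mem_filter.1 hv).2, sub_eq_zero.1 h4⟩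
      choose w hw hτX using hroot
      let M : Matrix (Fin n) (Fin n) F := Matrix.of fun a b => w b a
      have hτM : τ.restrictScalars F = act M := by
        apply MvPolynomial.algHom_ext
        intro b
        rw [act_X]
        exact hτX b
      have hτM' : ∀ s, τ s = act M s := fun s => DFunLike.congr_fun hτM s
      have hdet : M.det ≠ 0 := by
        intro h
        obtain ⟨v, hv0, hv⟩ := Matrix.exists_mulVec_eq_zero_iff.2 h
        have h1 := hτM' (linForm v)
        rw [act_linForm, hv, map_zero, map_eq_zero_iff _ hτ] at h1
        exact hv0 (linForm_injective (h1.trans (map_zero _).symm))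
      have h1 := hf (Matrix.GeneralLinearGroup.mkOfDetNeZero M hdet) (by
        intro a b hab
        exact hw b a ((I.monotone_sizeUpTo hab).trans (I.sizeUpTo_index_le a)))
      rw [pow_zero, one_smul] at h1
      rw [hτM']
      exact h1
  exact r.2

theorem mem_semiInv_zero_iff {I : Composition n} {f : MvPolynomial (Fin n) F} :
    f ∈ semiInv I 0 ↔ f ∈ parRing F I :=
  ⟨mem_parRing_of_mem_semiInv, parGen_mem_semiInv I⟩

end Galois

/-! ### Dimensions of the homogeneous parts of the ring of invariants -/

section Dimension

open MvPolynomial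

/-- The number of monomials of weighted degree `d`. -/
def weightCount {ι : Type*} (w : ι → ℕ) (d : ℕ) : ℕ :=
  Nat.card {e : ι →₀ ℕ // Finsupp.weight w e = d}

theorem finrank_weightedHomogeneousSubmodule (F : Type*) [Field F] {ι : Type*} (w : ι → ℕ)
    (d : ℕ) : Module.finrank F (weightedHomogeneousSubmodule F w d) = weightCount w d := by
  rw [weightedHomogeneousSubmodule_eq_finsupp_supported,
    (AddMonoidAlgebra.supportedEquivFinsupp _).finrank_eq,
    Module.finrank_eq_nat_card_basis Finsupp.basisSingleOne]
  rfl

/-- A substitution of homogeneous polynomials of degrees `w` for the variables respects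
components. -/
theorem homogeneousComponent_aeval {F : Type*} [Field F] {σ ι : Type*} {w : ι → ℕ}
    {f : ι → MvPolynomial σ F} (hf : ∀ i, (f i).IsHomogeneous (w i)) (d : ℕ)
    (p : MvPolynomial ι F) :
    homogeneousComponent d (aeval f p) = aeval f (weightedHomogeneousComponent w d p) := by
  induction p using MvPolynomial.induction_on' with
  | monomial e r =>
    have h1 : (aeval f (monomial e r)).IsHomogeneous (Finsupp.weight w e) := by
      rw [aeval_monomial, Finsupp.weight_apply, ← zero_add (Finsupp.sum _ _)]
      refine (isHomogeneous_C _ r).mul (IsHomogeneous.prod _ _ _ fun i _ => ?_)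
      have := (hf i).pow (e i)
      rwa [mul_comm] at this
    rw [homogeneousComponent_of_mem ((mem_homogeneousSubmodule _ _).2 h1),
      weightedHomogeneousComponent_of_mem (n := Finsupp.weight w e)
        (isWeightedHomogeneous_monomial w e r rfl)]
    split_ifs
    · rfl
    · rw [map_zero]
  | add p q hp hq => rw [map_add, map_add, hp, hq, map_add, map_add]

variable {F : Type*} [Field F] [Fintype F] {n : ℕ}

theorem finrank_invariants (I : Composition n) (d : ℕ) :
    Module.finrank F ↥(semiInv (F := F) I 0 ⊓ homogeneousSubmodule (Fin n) F d) =
      weightCount (parDeg (Fintype.card F) I) d := by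
  have hinj : Function.Injective (aeval (parGen F I)) := algebraicIndependent_parGen I
  have hmap : semiInv (F := F) I 0 ⊓ homogeneousSubmodule (Fin n) F d =
      (weightedHomogeneousSubmodule F (parDeg (Fintype.card F) I) d).map
        (aeval (parGen F I)).toLinearMap := by
    ext f
    rw [Submodule.mem_inf, mem_semiInv_zero_iff, parRing, Algebra.adjoin_range_eq_range_aeval,
      Submodule.mem_map, mem_homogeneousSubmodule]
    constructor
    · rintro ⟨⟨p, rfl⟩, hp⟩
      refine ⟨weightedHomogeneousComponent (parDeg (Fintype.card F) I) d p,
        weightedHomogeneousComponent_mem _ _ _, ?_⟩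
      rw [AlgHom.toLinearMap_apply,
        ← homogeneousComponent_aeval (fun i => isHomogeneous_parGen I i) d p]
      exact homogeneousComponent_eq_self hp
    · rintro ⟨p, hp, rfl⟩
      refine ⟨⟨p, rfl⟩, ?_⟩
      rw [AlgHom.toLinearMap_apply, ← weightedHomogeneousComponent_eq_self hp,
        ← homogeneousComponent_aeval (fun i => isHomogeneous_parGen I i) d p]
      exact homogeneousComponent_isHomogeneous _ _
  rw [hmap, ← finrank_weightedHomogeneousSubmodule F,
    (Submodule.equivMapOfInjective (aeval (parGen F I)).toLinearMap hinj _).finrank_eq]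

end Dimension

/-! ### Formal power series -/

section Series

open MvPowerSeries

variable {ι : Type*}

/-- The geometric series in the powers of `t ^ w`. -/
def geomSeries (w : ℕ) : MvPowerSeries (Fin 2) ℚ :=
  fun d => if d 1 = 0 ∧ w ∣ d 0 then 1 else 0

/-- The series in `t` with the numbers of monomials of given weighted degree. -/
def weightSeries (w : ι → ℕ) : MvPowerSeries (Fin 2) ℚ :=
  fun d => if d 1 = 0 then (weightCount w (d 0) : ℚ) else 0

theorem coeff_geomSeries (w : ℕ) (d : Fin 2 →₀ ℕ) :
    coeff d (geomSeries w) = if d 1 = 0 ∧ w ∣ d 0 then 1 else 0 := rfl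

theorem coeff_weightSeries (w : ι → ℕ) (d : Fin 2 →₀ ℕ) :
    coeff d (weightSeries w) = if d 1 = 0 then (weightCount w (d 0) : ℚ) else 0 := rfl

theorem geomSeries_mul (w : ℕ) (hw : 0 < w) : geomSeries w * (1 - X 0 ^ w) = 1 := by
  ext d
  have hd : d = 0 ↔ d 0 = 0 ∧ d 1 = 0 := by
    rw [Finsupp.ext_iff, Fin.forall_fin_two]; rfl
  have h0 : (d - Finsupp.single 0 w : Fin 2 →₀ ℕ) 0 = d 0 - w := by simp
  have h1 : (d - Finsupp.single 0 w : Fin 2 →₀ ℕ) 1 = d 1 := by simp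
  rw [mul_sub, mul_one, map_sub, X_pow_eq, coeff_mul_monomial, coeff_one, coeff_geomSeries,
    coeff_geomSeries, h0, h1, mul_one]
  simp only [Finsupp.single_le_iff, hd]
  by_cases hb : d 1 = 0
  · simp only [hb, true_and, and_true]
    by_cases ha : w ≤ d 0
    · have h2 : w ∣ d 0 - w ↔ w ∣ d 0 := (Nat.dvd_sub_iff_left ha dvd_rfl)
      rw [if_pos ha, if_neg (show d 0 ≠ 0 by omega)]
      simp only [h2, sub_self]
    · have h2 : w ∣ d 0 ↔ d 0 = 0 :=
        ⟨fun h => Nat.eq_zero_of_dvd_of_lt h (not_le.1 ha), fun h => h ▸ dvd_zero w⟩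
      rw [if_neg ha, sub_zero]
      simp only [h2]
  · simp [hb]

theorem weightSeries_eq_prod [Fintype ι] (w : ι → ℕ) (hw : ∀ i, 0 < w i) :
    weightSeries w = ∏ i, geomSeries (w i) := by
  classical
  ext d
  rw [coeff_prod]
  have h1 : ∀ l ∈ Finset.finsuppAntidiag Finset.univ d, ∏ i, coeff (l i) (geomSeries (w i)) =
      if ∀ i, l i 1 = 0 ∧ w i ∣ l i 0 then (1 : ℚ) else 0 := by
    intro l _
    simp only [coeff_geomSeries]
    rw [Finset.prod_boole]
    simp
  rw [Finset.sum_congr rfl h1, Finset.sum_boole, coeff_weightSeries]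
  split_ifs with hd
  · rw [weightCount, ← Nat.card_eq_finsetCard]
    congr 1
    have hval : ∀ l : ι →₀ (Fin 2 →₀ ℕ), l ∈ (Finset.finsuppAntidiag Finset.univ d).filter
        (fun l => ∀ i, l i 1 = 0 ∧ w i ∣ l i 0) ↔ ∑ i, l i = d ∧ ∀ i, l i 1 = 0 ∧ w i ∣ l i 0 := by
      intro l
      rw [Finset.mem_filter, Finset.mem_finsuppAntidiag]
      simp
    refine Nat.card_congr
      { toFun := fun e => ⟨Finsupp.equivFunOnFinite.symm fun i => Finsupp.single 0 (e.1 i * w i), ?_⟩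
        invFun := fun l => ⟨Finsupp.equivFunOnFinite.symm fun i => l.1 i 0 / w i, ?_⟩
        left_inv := ?_
        right_inv := ?_ }
    · rw [hval]
      refine ⟨?_, fun i => ?_⟩
      · have := e.2
        rw [Finsupp.weight_apply, Finsupp.sum_fintype _ _ (by simp)] at this
        ext a
        rw [Finsupp.finsetSum_apply]
        fin_cases a
        · simpa using this
        · simpa using hd.symm
      · simp
    · have := (hval _).1 l.2
      have h2 := DFunLike.congr_fun this.1 0
      rw [Finsupp.finsetSum_apply] at h2
      rw [Finsupp.weight_apply, Finsupp.sum_fintype _ _ (by simp)]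
      refine Eq.trans ?_ h2
      refine Finset.sum_congr rfl fun i _ => ?_
      simpa using Nat.div_mul_cancel (this.2 i).2
    · intro e
      ext i
      simp [hw i]
    · intro l
      have := (hval _).1 l.2
      ext i a
      fin_cases a
      · simpa using Nat.div_mul_cancel (this.2 i).2
      · simpa using (this.2 i).1.symm
  · symm
    rw [Nat.cast_eq_zero, Finset.card_eq_zero, Finset.filter_eq_empty_iff]
    intro l hl h
    rw [Finset.mem_finsuppAntidiag] at hl
    apply hd
    rw [← hl.1, Finsupp.finsetSum_apply]
    exact Finset.sum_eq_zero fun i _ => (h i).1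

theorem weightSeries_mul [Fintype ι] (w : ι → ℕ) (hw : ∀ i, 0 < w i) :
    weightSeries w * ∏ i, (1 - X 0 ^ w i) = 1 := by
  rw [weightSeries_eq_prod w hw, ← Finset.prod_mul_distrib]
  exact Finset.prod_eq_one fun i _ => geomSeries_mul _ (hw i)

end Series

/-! ### Complementary minors of the Moore matrix -/

section Minors

open MvPolynomial Set.powersetCard

/-- The expansion of an alternating form with respect to the standard basis. -/
theorem alternatingMap_eq_sum {S : Type*} [CommRing S] {n j : ℕ}
    (h : (Fin n → S) [⋀^Fin j]→ₗ[S] S) (ξ : Fin j → Fin n → S) :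
    h ξ = ∑ t : Set.powersetCard (Fin n) j,
      (Matrix.of fun a b => ξ a (ofFinEmbEquiv.symm t b)).det *
        h fun a => Pi.single (ofFinEmbEquiv.symm t a) 1 := by
  have h1 := (((Pi.basisFun S (Fin n)).exteriorPower j).sum_repr
    (exteriorPower.ιMulti S j ξ)).symm
  have h2 := congrArg (exteriorPower.alternatingMapLinearEquiv h) h1
  rw [exteriorPower.alternatingMapLinearEquiv_apply_ιMulti, map_sum] at h2
  rw [h2]
  refine Finset.sum_congr rfl fun t _ => ?_
  rw [map_smul, exteriorPower.basis_repr_apply, exteriorPower.ιMultiDual_apply_ιMulti,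
    exteriorPower.basis_apply, exteriorPower.ιMulti_family,
    exteriorPower.alternatingMapLinearEquiv_apply_ιMulti, smul_eq_mul]
  congr 2
  ext a
  simp

theorem extend_update {α β γ : Type*} [DecidableEq α] [DecidableEq β] {σ : α → β}
    (hσ : Function.Injective σ) (ξ : α → γ) (e : β → γ) (a : α) (x : γ) :
    Function.extend σ (Function.update ξ a x) e =
      Function.update (Function.extend σ ξ e) (σ a) x := by
  ext1 b
  by_cases hb : ∃ a', σ a' = b
  · obtain ⟨a', rfl⟩ := hb
    rw [hσ.extend_apply]
    rcases eq_or_ne a' a with rfl | h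
    · simp
    · rw [Function.update_of_ne h, Function.update_of_ne (hσ.ne h), hσ.extend_apply]
  · rw [Function.extend_apply' _ _ _ hb, Function.update_of_ne (by rintro rfl; exact hb ⟨a, rfl⟩),
      Function.extend_apply' _ _ _ hb]

/-- The determinant of a matrix in which some rows are replaced, as an alternating form in the
new rows. -/
def detReplace {S : Type*} [CommRing S] {n j : ℕ} (M : Matrix (Fin n) (Fin n) S)
    (σ : Fin j ↪o Fin n) : (Fin n → S) [⋀^Fin j]→ₗ[S] S where
  toFun ξ := Matrix.detRowAlternating (Function.extend σ ξ M.row)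
  map_update_add' ξ a x y := by
    simp only [extend_update σ.injective]
    exact AlternatingMap.map_update_add _ _ _ _ _
  map_update_smul' ξ a r x := by
    simp only [extend_update σ.injective]
    exact AlternatingMap.map_update_smul _ _ _ _ _
  map_eq_zero_of_eq' ξ a b hab hne := by
    refine AlternatingMap.map_eq_zero_of_eq _ _ (i := σ a) (j := σ b) ?_ (σ.injective.ne hne)
    rw [σ.injective.extend_apply, σ.injective.extend_apply, hab]

theorem detReplace_apply {S : Type*} [CommRing S] {n j : ℕ} (M : Matrix (Fin n) (Fin n) S)
    (σ : Fin j ↪o Fin n) (ξ : Fin j → Fin n → S) :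
    detReplace M σ ξ = (Matrix.of (Function.extend σ ξ M.row)).det := rfl

/-- The matrix of the minors of size `j`. -/
def compound {S : Type*} [CommRing S] {n : ℕ} (M : Matrix (Fin n) (Fin n) S) (j : ℕ) :
    Matrix (Set.powersetCard (Fin n) j) (Set.powersetCard (Fin n) j) S :=
  Matrix.of fun s t => (M.submatrix (ofFinEmbEquiv.symm s) (ofFinEmbEquiv.symm t)).det

/-- The matrix of the signed complementary minors. -/
def cofactors {S : Type*} [CommRing S] {n : ℕ} (M : Matrix (Fin n) (Fin n) S) (j : ℕ) :
    Matrix (Set.powersetCard (Fin n) j) (Set.powersetCard (Fin n) j) S :=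
  Matrix.of fun t s => detReplace M (ofFinEmbEquiv.symm s)
    fun a => Pi.single (ofFinEmbEquiv.symm t a) 1

/-- The Laplace expansion. -/
theorem compound_mul_cofactors {S : Type*} [CommRing S] {n : ℕ} (M : Matrix (Fin n) (Fin n) S)
    (j : ℕ) : compound M j * cofactors M j = M.det • 1 := by
  ext s' s
  have h := alternatingMap_eq_sum (detReplace M (ofFinEmbEquiv.symm s))
    fun a => M.row (ofFinEmbEquiv.symm s' a)
  rw [Matrix.mul_apply, Matrix.smul_apply, Matrix.one_apply, smul_eq_mul]
  refine h.symm.trans ?_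
  rw [detReplace_apply]
  split_ifs with hs
  · subst hs
    rw [mul_one]
    congr 1
    ext i b
    rw [Matrix.of_apply]
    by_cases hi : ∃ a, ofFinEmbEquiv.symm s' a = i
    · obtain ⟨a, rfl⟩ := hi
      rw [(ofFinEmbEquiv.symm s').injective.extend_apply, Matrix.row_apply]
    · rw [Function.extend_apply' _ _ _ hi, Matrix.row_apply]
  · rw [mul_zero]
    obtain ⟨i, hi', hi⟩ := (exists_mem_notMem_iff_ne s' s).1 hs
    rw [← mem_range_ofFinEmbEquiv_symm_iff_mem] at hi hi'
    obtain ⟨a, rfl⟩ := hi'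
    refine Matrix.det_zero_of_row_eq (i := ofFinEmbEquiv.symm s a)
      (j := ofFinEmbEquiv.symm s' a) (fun h => hi ⟨a, h⟩) (funext fun b => ?_)
    rw [Matrix.of_apply, Matrix.of_apply, (ofFinEmbEquiv.symm s).injective.extend_apply,
      Function.extend_apply' _ _ _ hi]

theorem cofactors_mul_compound {S : Type*} [CommRing S] [IsDomain S] {n : ℕ}
    {M : Matrix (Fin n) (Fin n) S} (hM : M.det ≠ 0) (j : ℕ) :
    cofactors M j * compound M j = M.det • 1 := by
  have h := compound_mul_cofactors M j
  have hdet : (compound M j).det ≠ 0 := by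
    intro h0
    have := congrArg Matrix.det h
    rw [Matrix.det_mul, h0, zero_mul, Matrix.det_smul, Matrix.det_one, mul_one] at this
    exact pow_ne_zero _ hM this.symm
  have h1 : compound M j * (cofactors M j * compound M j - M.det • 1) = 0 := by
    rw [mul_sub, ← mul_assoc, h, smul_mul_assoc, one_mul, mul_smul_comm, mul_one, sub_self]
  have h2 := congrArg ((compound M j).adjugate * ·) h1
  simp only [← mul_assoc, Matrix.adjugate_mul, mul_zero, smul_mul_assoc, one_mul] at h2
  exact sub_eq_zero.1 ((smul_eq_zero_iff_right hdet).1 h2)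

variable {F : Type*} [Field F] [Fintype F] {n j : ℕ}

theorem sum_ofFinEmbEquiv_symm (f : Fin n → ℕ) (s : Set.powersetCard (Fin n) j) :
    ∑ a, f (ofFinEmbEquiv.symm s a) = ∑ i ∈ s.val, f i := by
  refine Finset.sum_bij (fun a _ => ofFinEmbEquiv.symm s a) (fun a _ => ?_)
    (fun a _ b _ h => (ofFinEmbEquiv.symm s).injective h) (fun i hi => ?_) fun _ _ => rfl
  · exact (mem_range_ofFinEmbEquiv_symm_iff_mem s _).1 ⟨a, rfl⟩
  · obtain ⟨a, ha⟩ := (mem_range_ofFinEmbEquiv_symm_iff_mem s i).2 hi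
    exact ⟨a, Finset.mem_univ _, ha⟩

theorem isHomogeneous_compound (s t : Set.powersetCard (Fin n) j) :
    (compound (moore F n) j s t).IsHomogeneous (∑ i ∈ s.val, Fintype.card F ^ (i : ℕ)) := by
  rw [← sum_ofFinEmbEquiv_symm (fun i => Fintype.card F ^ (i : ℕ))]
  exact isHomogeneous_det F n fun a b => isHomogeneous_moore F n _ _

theorem isHomogeneous_cofactors (s t : Set.powersetCard (Fin n) j) :
    (cofactors (moore F n) j t s).IsHomogeneous (∑ i ∈ s.valᶜ, Fintype.card F ^ (i : ℕ)) := by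
  have h : ∑ i ∈ s.valᶜ, Fintype.card F ^ (i : ℕ) =
      ∑ i, if i ∈ s.val then 0 else Fintype.card F ^ (i : ℕ) := by
    rw [Finset.sum_ite, Finset.sum_const_zero, zero_add]
    congr 1
    ext i
    simp
  rw [h]
  refine isHomogeneous_det F n fun i b => ?_
  split_ifs with hi
  · obtain ⟨a, rfl⟩ := (mem_range_ofFinEmbEquiv_symm_iff_mem s i).2 hi
    rw [(ofFinEmbEquiv.symm s).injective.extend_apply, Pi.single_apply]
    split_ifs
    · exact isHomogeneous_one _ _
    · exact isHomogeneous_zero _ _ _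
  · have hi' := mt (mem_range_ofFinEmbEquiv_symm_iff_mem s i).1 hi
    rw [Function.extend_apply' _ _ _ hi']
    exact isHomogeneous_moore F n i b

omit [Fintype F] in
theorem homogeneousComponent_mul_of_isHomogeneous {σ : Type*} {P : MvPolynomial σ F} {a : ℕ}
    (hP : P.IsHomogeneous a) (h : MvPolynomial σ F) (i : ℕ) :
    homogeneousComponent (a + i) (P * h) = P * homogeneousComponent i h := by
  conv_lhs => rw [← sum_homogeneousComponent h, Finset.mul_sum, map_sum]
  have h1 : ∀ l, homogeneousComponent (a + i) (P * homogeneousComponent l h) =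
      if i = l then P * homogeneousComponent l h else 0 := by
    intro l
    rw [homogeneousComponent_of_mem ((mem_homogeneousSubmodule _ _).2
      (hP.mul (homogeneousComponent_isHomogeneous l h)))]
    simp only [add_right_inj]
  simp only [h1]
  rw [Finset.sum_ite_eq]
  split_ifs with h2
  · rfl
  · rw [Finset.mem_range, not_lt] at h2
    rw [homogeneousComponent_eq_zero _ _ (by omega), mul_zero]

omit [Fintype F] in
theorem isHomogeneous_of_mul {σ : Type*} {P h : MvPolynomial σ F} {a i : ℕ}
    (hP : P.IsHomogeneous a) (hP0 : P ≠ 0) (hh : (P * h).IsHomogeneous (a + i)) :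
    h.IsHomogeneous i := by
  have h1 := homogeneousComponent_mul_of_isHomogeneous hP h i
  rw [homogeneousComponent_eq_self ((mem_homogeneousSubmodule _ _).2 hh)] at h1
  rw [mul_left_cancel₀ hP0 h1]
  exact homogeneousComponent_isHomogeneous _ _

end Minors

/-! ### Pairing invariants with products of Frobenius powers -/

section Pairing

open MvPolynomial Set.powersetCard

variable (F : Type*) [Field F] (n : ℕ)

/-- The symmetric algebra of `F ^ n` as a polynomial ring. -/
def toPoly : SymmetricAlgebra F (Fin n → F) ≃ₐ[F] MvPolynomial (Fin n) F :=
  SymmetricAlgebra.equivMvPolynomial (Pi.basisFun F (Fin n))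

variable {F n}

theorem toPoly_ι (v : Fin n → F) : toPoly F n (SymmetricAlgebra.ι F _ v) = linForm v := by
  have h : (toPoly F n).toLinearMap ∘ₗ SymmetricAlgebra.ι F (Fin n → F) = linForm := by
    refine (Pi.basisFun F (Fin n)).ext fun b => ?_
    rw [LinearMap.comp_apply, AlgEquiv.toLinearMap_apply, toPoly,
      SymmetricAlgebra.equivMvPolynomial_ι_apply, Pi.basisFun_apply, linForm_single]
  exact DFunLike.congr_fun h v

theorem toPoly_symAlgRep (g : Matrix.GeneralLinearGroup (Fin n) F)
    (a : SymmetricAlgebra F (Fin n → F)) :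
    toPoly F n (symAlgRep (stdRep F n) g a) = act g.1 (toPoly F n a) := by
  have h : ((toPoly F n : _ →ₐ[F] _).comp (symMap (stdRep F n g))) =
      (act g.1).comp (toPoly F n : _ →ₐ[F] _) := by
    apply SymmetricAlgebra.algHom_ext
    refine LinearMap.ext fun v => ?_
    change toPoly F n (symMap (stdRep F n g) (SymmetricAlgebra.ι F _ _)) =
      act g.1 (toPoly F n (SymmetricAlgebra.ι F _ _))
    rw [symMap, SymmetricAlgebra.lift_ι_apply, LinearMap.comp_apply, toPoly_ι, toPoly_ι,
      act_linForm]
    rfl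
  exact DFunLike.congr_fun h a

theorem map_toPoly_symPow (i : ℕ) :
    (symPow F (Fin n → F) i).map (toPoly F n).toLinearMap = homogeneousSubmodule (Fin n) F i := by
  have h1 : (LinearMap.range (SymmetricAlgebra.ι F (Fin n → F))).map (toPoly F n).toLinearMap =
      homogeneousSubmodule (Fin n) F 1 := by
    rw [homogeneousSubmodule_one_eq_span_X]
    apply le_antisymm
    · rintro _ ⟨_, ⟨v, rfl⟩, rfl⟩
      rw [AlgEquiv.toLinearMap_apply, toPoly_ι, linForm_apply]
      exact Submodule.sum_mem _ fun a _ =>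
        Submodule.smul_mem _ _ (Submodule.subset_span ⟨a, rfl⟩)
    · rw [Submodule.span_le]
      rintro _ ⟨a, rfl⟩
      exact ⟨_, ⟨Pi.single a 1, rfl⟩, by
        rw [AlgEquiv.toLinearMap_apply, toPoly_ι, linForm_single]⟩
  have h2 := Submodule.map_pow (LinearMap.range (SymmetricAlgebra.ι F (Fin n → F)))
    (toPoly F n : SymmetricAlgebra F (Fin n → F) →ₐ[F] MvPolynomial (Fin n) F) i
  rw [← homogeneousSubmodule_one_pow, ← h1]
  exact h2

theorem mem_symPow_iff (i : ℕ) (a : SymmetricAlgebra F (Fin n → F)) :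
    a ∈ symPow F (Fin n → F) i ↔ (toPoly F n a).IsHomogeneous i := by
  rw [← mem_homogeneousSubmodule, ← map_toPoly_symPow]
  refine ⟨fun h => ⟨a, h, rfl⟩, ?_⟩
  rintro ⟨b, hb, h⟩
  exact (toPoly F n).injective h ▸ hb

variable [Fintype F] {j : ℕ}

/-- The equivariant linear map from vectors to polynomials given by a Frobenius power. -/
def frobForm (i : ℕ) : (Fin n → F) →ₗ[F] MvPolynomial (Fin n) F :=
  (FiniteField.frobeniusAlgHom F (MvPolynomial (Fin n) F) ^ i).toLinearMap ∘ₗ linForm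

theorem frobForm_apply (i : ℕ) (v : Fin n → F) :
    frobForm i v = linForm v ^ Fintype.card F ^ i := by
  rw [frobForm, LinearMap.comp_apply, AlgHom.toLinearMap_apply, AlgHom.coe_pow,
    FiniteField.coe_frobeniusAlgHom, pow_iterate]

/-- Evaluation of the exterior product of the Frobenius powers with exponents in `s`. -/
def extPair (s : Set.powersetCard (Fin n) j) : ⋀[F]^j (Fin n → F) →ₗ[F] MvPolynomial (Fin n) F :=
  exteriorPower.alternatingMapLinearEquiv
    { ((Matrix.detRowAlternating (n := Fin j)
          (R := MvPolynomial (Fin n) F)).toMultilinearMap.restrictScalars F).compLinearMap fun _ =>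
        LinearMap.pi fun a => frobForm (ofFinEmbEquiv.symm s a : Fin n) with
      map_eq_zero_of_eq' := fun v b c h hbc =>
        Matrix.detRowAlternating.map_eq_zero_of_eq _ (by dsimp only; rw [h]) hbc }

theorem extPair_ιMulti (s : Set.powersetCard (Fin n) j) (v : Fin j → Fin n → F) :
    extPair s (exteriorPower.ιMulti F j v) =
      (Matrix.of fun b a => frobForm (ofFinEmbEquiv.symm s a : Fin n) (v b)).det := by
  rw [extPair, exteriorPower.alternatingMapLinearEquiv_apply_ιMulti]
  rfl

theorem extPair_map (s : Set.powersetCard (Fin n) j) (g : Matrix.GeneralLinearGroup (Fin n) F)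
    (w : ⋀[F]^j (Fin n → F)) :
    extPair s (extPowRep (stdRep F n) j g w) = act g.1 (extPair s w) := by
  have h : (extPair s) ∘ₗ (exteriorPower.map j (stdRep F n g)) =
      (act g.1).toLinearMap ∘ₗ extPair s := by
    apply exteriorPower.linearMap_ext
    ext1 v
    simp only [LinearMap.compAlternatingMap_apply, LinearMap.comp_apply,
      exteriorPower.map_apply_ιMulti, extPair_ιMulti, AlgHom.toLinearMap_apply]
    rw [AlgHom.map_det]
    congr 1
    ext1 b a
    rw [AlgHom.mapMatrix_apply, Matrix.map_apply, Matrix.of_apply, Matrix.of_apply, frobForm_apply,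
      frobForm_apply, map_pow, act_linForm]
    rfl
  exact DFunLike.congr_fun h w

/-- The standard basis of the exterior power. -/
abbrev extBasis : Module.Basis (Set.powersetCard (Fin n) j) F (⋀[F]^j (Fin n → F)) :=
  (Pi.basisFun F (Fin n)).exteriorPower j

theorem extPair_basis (s t : Set.powersetCard (Fin n) j) :
    extPair s (extBasis (F := F) t) = compound (moore F n) j s t := by
  rw [exteriorPower.basis_apply, exteriorPower.ιMulti_family, extPair_ιMulti, compound,
    Matrix.of_apply, ← Matrix.det_transpose]
  congr 1
  ext1 a b
  rw [Matrix.transpose_apply, Matrix.of_apply, Matrix.submatrix_apply, frobForm_apply, moore,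
    Matrix.of_apply, Function.comp_apply, Pi.basisFun_apply, linForm_single]

/-- The pairing of `S ^ i (V) ⊗ ∧ ^ j (V) ⊗ Det ^ k` with the exterior product of the Frobenius
powers with exponents in `s`. -/
def pairing (i : ℕ) (s : Set.powersetCard (Fin n) j) :
    (symPow F (Fin n → F) i ⊗[F] ⋀[F]^j (Fin n → F)) ⊗[F] F →ₗ[F] MvPolynomial (Fin n) F :=
  LinearMap.mul' F (MvPolynomial (Fin n) F) ∘ₗ
    TensorProduct.map ((toPoly F n).toLinearMap ∘ₗ (symPow F (Fin n → F) i).subtype) (extPair s) ∘ₗ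
      (TensorProduct.rid F _).toLinearMap

theorem pairing_tmul (i : ℕ) (s : Set.powersetCard (Fin n) j) (a : symPow F (Fin n → F) i)
    (w : ⋀[F]^j (Fin n → F)) (r : F) :
    pairing i s ((a ⊗ₜ w) ⊗ₜ r) = r • (toPoly F n a * extPair s w) := by
  simp [pairing]

theorem pairing_rep (i k : ℕ) (s : Set.powersetCard (Fin n) j)
    (g : Matrix.GeneralLinearGroup (Fin n) F)
    (x : (symPow F (Fin n → F) i ⊗[F] ⋀[F]^j (Fin n → F)) ⊗[F] F) :
    pairing i s ((((symPowRep (stdRep F n) i).tprod (extPowRep (stdRep F n) j)).tprod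
      (detPowRep F n k)) g x) =
      (g : Matrix (Fin n) (Fin n) F).det ^ k • act g.1 (pairing i s x) := by
  induction x with
  | zero => simp
  | add x y hx hy => rw [map_add, map_add, hx, hy, map_add, map_add, smul_add]
  | tmul y r =>
    induction y with
    | zero => simp
    | add x y hx hy =>
      rw [TensorProduct.add_tmul, map_add, map_add, hx, hy, map_add, map_add, smul_add]
    | tmul a w =>
      have h1 : toPoly F n (symPowRep (stdRep F n) i g a : SymmetricAlgebra F (Fin n → F)) =
          act g.1 (toPoly F n a) := toPoly_symAlgRep g a
      have h2 : detPowRep F n k g r = (g : Matrix (Fin n) (Fin n) F).det ^ k * r := rfl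
      rw [Representation.tprod_apply, Representation.tprod_apply, TensorProduct.map_tmul,
        TensorProduct.map_tmul, pairing_tmul, pairing_tmul, h1, h2, extPair_map, map_smul, map_mul,
        mul_smul]

theorem pairing_isHomogeneous (i : ℕ) (s : Set.powersetCard (Fin n) j)
    (x : (symPow F (Fin n → F) i ⊗[F] ⋀[F]^j (Fin n → F)) ⊗[F] F) :
    (pairing i s x).IsHomogeneous (i + ∑ a ∈ s.val, Fintype.card F ^ (a : ℕ)) := by
  rw [← mem_homogeneousSubmodule]
  have hw : ∀ w : ⋀[F]^j (Fin n → F), extPair s w ∈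
      homogeneousSubmodule (Fin n) F (∑ a ∈ s.val, Fintype.card F ^ (a : ℕ)) := by
    intro w
    rw [← extBasis.sum_repr w, map_sum]
    refine Submodule.sum_mem _ fun t _ => ?_
    rw [map_smul, extPair_basis]
    exact Submodule.smul_mem _ _ (isHomogeneous_compound s t)
  induction x with
  | zero => simp
  | add x y hx hy => rw [map_add]; exact add_mem hx hy
  | tmul y r =>
    induction y with
    | zero => simp
    | add x y hx hy => rw [TensorProduct.add_tmul, map_add]; exact add_mem hx hy
    | tmul a w =>
      rw [pairing_tmul]
      exact Submodule.smul_mem _ _ (((mem_symPow_iff i a.1).1 a.2).mul (hw w))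

/-- The tensor with given coordinates. -/
def ofCoords (i : ℕ) (a : Set.powersetCard (Fin n) j → symPow F (Fin n → F) i) :
    (symPow F (Fin n → F) i ⊗[F] ⋀[F]^j (Fin n → F)) ⊗[F] F :=
  (∑ t, a t ⊗ₜ extBasis t) ⊗ₜ 1

omit [Fintype F] in
theorem exists_ofCoords (i : ℕ)
    (x : (symPow F (Fin n → F) i ⊗[F] ⋀[F]^j (Fin n → F)) ⊗[F] F) :
    ∃ a, x = ofCoords i a := by
  obtain ⟨y, rfl⟩ := (TensorProduct.rid F _).symm.surjective x
  obtain ⟨c, rfl⟩ := (TensorProduct.equivFinsuppOfBasisRight extBasis).symm.surjective y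
  refine ⟨c, ?_⟩
  rw [TensorProduct.rid_symm_apply, TensorProduct.equivFinsuppOfBasisRight_symm_apply,
    Finsupp.sum_fintype _ _ (by simp), ofCoords]

theorem pairing_ofCoords (i : ℕ) (s : Set.powersetCard (Fin n) j)
    (a : Set.powersetCard (Fin n) j → symPow F (Fin n → F) i) :
    pairing i s (ofCoords i a) =
      (compound (moore F n) j).mulVec (fun t => toPoly F n (a t).1) s := by
  rw [ofCoords, TensorProduct.sum_tmul, map_sum]
  refine Finset.sum_congr rfl fun t _ => ?_
  rw [pairing_tmul, extPair_basis, one_smul, mul_comm]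

/-- A tensor is determined by its pairings, as the Moore determinant is nonzero. -/
theorem eq_of_pairing_eq (i : ℕ)
    {x y : (symPow F (Fin n → F) i ⊗[F] ⋀[F]^j (Fin n → F)) ⊗[F] F}
    (h : ∀ s : Set.powersetCard (Fin n) j, pairing i s x = pairing i s y) : x = y := by
  obtain ⟨a, rfl⟩ := exists_ofCoords i x
  obtain ⟨b, rfl⟩ := exists_ofCoords i y
  have h1 : (compound (moore F n) j).mulVec (fun t => toPoly F n (a t).1) =
      (compound (moore F n) j).mulVec (fun t => toPoly F n (b t).1) := by
    ext1 s
    rw [← pairing_ofCoords, ← pairing_ofCoords, h]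
  have h2 := congrArg ((cofactors (moore F n) j).mulVec) h1
  rw [Matrix.mulVec_mulVec, Matrix.mulVec_mulVec, cofactors_mul_compound (det_moore_ne_zero F n),
    Matrix.smul_mulVec, Matrix.smul_mulVec, Matrix.one_mulVec, Matrix.one_mulVec] at h2
  congr 1
  ext1 t
  have h3 := congrFun h2 t
  rw [Pi.smul_apply, Pi.smul_apply, smul_eq_mul, smul_eq_mul] at h3
  exact Subtype.ext ((toPoly F n).injective (mul_left_cancel₀ (det_moore_ne_zero F n) h3))

theorem isHomogeneous_det_moore :
    (moore F n).det.IsHomogeneous (∑ i : Fin n, Fintype.card F ^ (i : ℕ)) :=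
  isHomogeneous_det F n fun i a => isHomogeneous_moore F n i a

/-- Multiples of the Moore determinant are values of the pairings. -/
theorem exists_pairing_eq (i : ℕ) {y : Set.powersetCard (Fin n) j → MvPolynomial (Fin n) F}
    (hy : ∀ s, (y s).IsHomogeneous (i + ∑ a ∈ s.val, Fintype.card F ^ (a : ℕ)))
    (hdvd : ∀ s, (moore F n).det ∣ y s) :
    ∃ x : (symPow F (Fin n → F) i ⊗[F] ⋀[F]^j (Fin n → F)) ⊗[F] F,
      ∀ s, pairing i s x = y s := by
  choose h hh using hdvd
  have hp : ∀ t, ((cofactors (moore F n) j).mulVec h t).IsHomogeneous i := by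
    intro t
    refine isHomogeneous_of_mul isHomogeneous_det_moore (det_moore_ne_zero F n) ?_
    rw [Matrix.mulVec, dotProduct, Finset.mul_sum]
    refine IsHomogeneous.sum _ _ _ fun s _ => ?_
    rw [mul_left_comm, ← hh]
    have h1 := (isHomogeneous_cofactors (F := F) s t).mul (hy s)
    have h2 : ∑ a ∈ s.valᶜ, Fintype.card F ^ (a : ℕ) +
        (i + ∑ a ∈ s.val, Fintype.card F ^ (a : ℕ)) = ∑ a : Fin n, Fintype.card F ^ (a : ℕ) + i := by
      rw [← Finset.sum_compl_add_sum s.val]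
      ring
    rwa [h2] at h1
  refine ⟨ofCoords i fun t => ⟨(toPoly F n).symm ((cofactors (moore F n) j).mulVec h t), ?_⟩,
    fun s => ?_⟩
  · rw [mem_symPow_iff, AlgEquiv.apply_symm_apply]
    exact hp t
  · rw [pairing_ofCoords]
    simp only [AlgEquiv.apply_symm_apply]
    rw [Matrix.mulVec_mulVec, compound_mul_cofactors, Matrix.smul_mulVec, Matrix.one_mulVec,
      Pi.smul_apply, smul_eq_mul, ← hh]

omit [Fintype F] in
theorem mem_tensorDetInvariants {A B : Type*} [AddCommGroup A] [Module F A] [AddCommGroup B]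
    [Module F B] (ρ : Representation F (Matrix.GeneralLinearGroup (Fin n) F) A)
    (σ : Representation F (Matrix.GeneralLinearGroup (Fin n) F) B) (I : Composition n) (k : ℕ)
    (x : (A ⊗[F] B) ⊗[F] F) : x ∈ tensorDetInvariants ρ σ I k ↔
      ∀ g ∈ parabolic F I, ((ρ.tprod σ).tprod (detPowRep F n k)) g x = x :=
  ⟨fun h g hg => h ⟨g, hg⟩, fun h g => h g.1 g.2⟩

/-- A tensor is invariant if and only if its pairings are semi-invariants. -/
theorem mem_gradedInvariants_iff (I : Composition n) (k i : ℕ)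
    (x : (symPow F (Fin n → F) i ⊗[F] ⋀[F]^j (Fin n → F)) ⊗[F] F) :
    x ∈ gradedInvariants F I k i j ↔
      ∀ s : Set.powersetCard (Fin n) j, pairing i s x ∈ semiInv I k := by
  rw [gradedInvariants, mem_tensorDetInvariants]
  constructor
  · intro hx s g hg
    rw [← pairing_rep, hx g hg]
  · intro hx g hg
    refine eq_of_pairing_eq i fun s => ?_
    rw [pairing_rep, hx s g hg]

/-- The pairings of an invariant, as a family of homogeneous semi-invariants. -/
def gradedInvariantsToPi (I : Composition n) (k i : ℕ) :
    gradedInvariants F I k i j →ₗ[F] ((s : Set.powersetCard (Fin n) j) →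
      ↥(semiInv (F := F) I k ⊓ homogeneousSubmodule (Fin n) F
        (i + ∑ a ∈ s.val, Fintype.card F ^ (a : ℕ)))) :=
  LinearMap.pi fun s => LinearMap.codRestrict _ ((pairing i s) ∘ₗ Submodule.subtype _) fun x =>
    ⟨(mem_gradedInvariants_iff I k i x.1).1 x.2 s, pairing_isHomogeneous i s x.1⟩

theorem gradedInvariantsToPi_bijective (I : Composition n) (k i : ℕ)
    (hk : ¬ Fintype.card F - 1 ∣ k) :
    Function.Bijective (gradedInvariantsToPi (F := F) (j := j) I k i) := by
  constructor
  · intro x y hxy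
    exact Subtype.ext (eq_of_pairing_eq i fun s => congrArg Subtype.val (congrFun hxy s))
  · intro y
    obtain ⟨x, hx⟩ := exists_pairing_eq (F := F) (j := j) i (y := fun s => (y s).1)
      (fun s => (y s).2.2) fun s => det_moore_dvd hk (y s).2.1
    refine ⟨⟨x, (mem_gradedInvariants_iff I k i x).2 fun s => ?_⟩,
      funext fun s => Subtype.ext (hx s)⟩
    rw [hx]
    exact (y s).2.1

end Pairing

/-! ### The Hilbert series -/

section HilbertSeries

section Semiinvariants

open MvPolynomial

variable {F : Type*} [Field F] [Fintype F] {n : ℕ}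

theorem finrank_semiInv (I : Composition n) {k e : ℕ} (hk : 1 ≤ k)
    (he : k + e = Fintype.card F - 1) (d : ℕ) :
    Module.finrank F ↥(semiInv (F := F) I k ⊓ homogeneousSubmodule (Fin n) F d) =
      if e * ∑ i : Fin n, Fintype.card F ^ (i : ℕ) ≤ d then
        weightCount (parDeg (Fintype.card F) I) (d - e * ∑ i : Fin n, Fintype.card F ^ (i : ℕ))
      else 0 := by
  set N := ∑ i : Fin n, Fintype.card F ^ (i : ℕ) with hN
  have hP : ((moore F n).det ^ e).IsHomogeneous (e * N) := by
    rw [mul_comm]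
    exact isHomogeneous_det_moore.pow e
  have hP0 : (moore F n).det ^ e ≠ 0 := pow_ne_zero _ (det_moore_ne_zero F n)
  split_ifs with hd
  · have hmap : semiInv (F := F) I k ⊓ homogeneousSubmodule (Fin n) F d =
        (semiInv (F := F) I 0 ⊓ homogeneousSubmodule (Fin n) F (d - e * N)).map
          (LinearMap.mulLeft F ((moore F n).det ^ e)) := by
      ext f
      rw [Submodule.mem_inf, mem_semiInv_iff hk he, mem_homogeneousSubmodule, Submodule.mem_map]
      constructor
      · rintro ⟨⟨h, hh, rfl⟩, hf⟩
        refine ⟨h, ⟨hh, isHomogeneous_of_mul hP hP0 ?_⟩, rfl⟩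
        rwa [Nat.add_sub_cancel' hd]
      · rintro ⟨h, ⟨hh, hh'⟩, rfl⟩
        refine ⟨⟨h, hh, rfl⟩, ?_⟩
        have := hP.mul hh'
        rwa [Nat.add_sub_cancel' hd] at this
    rw [hmap, ← finrank_invariants]
    exact (Submodule.equivMapOfInjective (LinearMap.mulLeft F ((moore F n).det ^ e))
      (mul_right_injective₀ hP0) _).symm.finrank_eq
  · have hbot : semiInv (F := F) I k ⊓ homogeneousSubmodule (Fin n) F d = ⊥ := by
      rw [eq_bot_iff]
      intro f hf
      obtain ⟨h, -, rfl⟩ := (mem_semiInv_iff hk he).1 hf.1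
      by_contra h0
      have h1 : h ≠ 0 := by
        rintro rfl
        exact h0 (mul_zero _)
      have h2 := IsHomogeneous.totalDegree hf.2 h0
      rw [totalDegree_mul_of_isDomain hP0 h1, hP.totalDegree hP0] at h2
      omega
    rw [hbot, finrank_bot]

theorem finrank_gradedInvariants (I : Composition n) {k e : ℕ} (hk : 1 ≤ k) (he₁ : 1 ≤ e)
    (he : k + e = Fintype.card F - 1) (i j : ℕ) :
    Module.finrank F (gradedInvariants F I k i j) =
      ∑ s : Set.powersetCard (Fin n) j,
        if (e - 1) * ∑ a : Fin n, Fintype.card F ^ (a : ℕ) +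
            ∑ a ∈ s.valᶜ, Fintype.card F ^ (a : ℕ) ≤ i then
          weightCount (parDeg (Fintype.card F) I) (i - ((e - 1) *
            ∑ a : Fin n, Fintype.card F ^ (a : ℕ) + ∑ a ∈ s.valᶜ, Fintype.card F ^ (a : ℕ)))
        else 0 := by
  have hk' : ¬ Fintype.card F - 1 ∣ k := Nat.not_dvd_of_pos_of_lt hk (by omega)
  have hfin : ∀ d, Module.Finite F
      ↥(semiInv (F := F) I k ⊓ homogeneousSubmodule (Fin n) F d) := fun d =>
    have : Module.Finite F (homogeneousSubmodule (Fin n) F d) :=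
      Module.Finite.iff_fg.2 (homogeneousSubmodule_fg _ _ d)
    Submodule.finiteDimensional_of_le inf_le_right
  rw [(LinearEquiv.ofBijective _
    (gradedInvariantsToPi_bijective (F := F) (j := j) I k i hk')).finrank_eq,
    Module.finrank_pi_fintype]
  refine Finset.sum_congr rfl fun s _ => ?_
  rw [finrank_semiInv I hk he]
  obtain ⟨e, rfl⟩ := Nat.exists_eq_add_of_le' he₁
  -- Families for `s` have degree `i + ∑ a ∈ s, q ^ a`; subtracting one full sum
  -- `∑ a, q ^ a` leaves the exponent `e - 1` and the sum over the complement of `s`.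
  have h := Finset.sum_compl_add_sum s.val fun a : Fin n => Fintype.card F ^ (a : ℕ)
  rw [Nat.add_sub_cancel, add_mul, one_mul]
  rw [← h]
  set A := ∑ a ∈ s.valᶜ, Fintype.card F ^ (a : ℕ)
  set B := ∑ a ∈ s.val, Fintype.card F ^ (a : ℕ)
  set E := e * (A + B)
  by_cases hc : E + A ≤ i
  · rw [if_pos hc, if_pos (by omega)]
    congr 1
    omega
  · rw [if_neg hc, if_neg (by omega)]

end Semiinvariants

open MvPowerSeries

theorem parDeg_pos {n q : ℕ} (hq : 1 < q) (I : Composition n)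
    (p : Σ i : Fin I.length, Fin (I.blocksFun i)) : 0 < parDeg q I p := by
  rw [parDeg, I.sizeUpTo_succ']
  exact Nat.sub_pos_of_lt (Nat.pow_lt_pow_right hq (by have := p.2.2; omega))

theorem weightSeries_parDeg {n q : ℕ} (hq : 1 < q) (I : Composition n) :
    weightSeries (parDeg q I) =
      (∏ i : Fin I.length, ∏ j ∈ Finset.Icc 1 (I.blocksFun i),
        (1 - X 0 ^ (q ^ I.sizeUpTo (i + 1) - q ^ (I.sizeUpTo (i + 1) - j))))⁻¹ := by
  have h := weightSeries_mul (parDeg q I) (parDeg_pos hq I)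
  rw [Fintype.prod_sigma] at h
  have h1 : ∀ i : Fin I.length, ∏ j : Fin (I.blocksFun i),
      (1 - X 0 ^ parDeg q I ⟨i, j⟩ : MvPowerSeries (Fin 2) ℚ) =
      ∏ j ∈ Finset.Icc 1 (I.blocksFun i),
        (1 - X 0 ^ (q ^ I.sizeUpTo (i + 1) - q ^ (I.sizeUpTo (i + 1) - j))) := by
    intro i
    -- The generator of index `j` has degree `q ^ m - q ^ (m - (I.blocksFun i - j))`, where `m` is
    -- the end of the block.
    refine Finset.prod_bij (fun j _ => I.blocksFun i - j) (fun j _ => ?_) (fun j _ j' _ hj => ?_)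
      (fun j hj => ?_) (fun j _ => ?_)
    · rw [Finset.mem_Icc]
      have := j.2
      omega
    · have := j.2
      have := j'.2
      ext
      omega
    · rw [Finset.mem_Icc] at hj
      exact ⟨⟨I.blocksFun i - j, by omega⟩, Finset.mem_univ _, by dsimp only; omega⟩
    · rw [parDeg, I.sizeUpTo_succ']
      congr 4
      have := j.2
      dsimp only
      omega
  rw [Finset.prod_congr rfl fun i _ => h1 i] at h
  rw [MvPowerSeries.eq_inv_iff_mul_eq_one]
  · exact h
  · intro h0
    have h2 := congrArg constantCoeff h
    rw [map_mul, h0, mul_zero, map_one] at h2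
    exact zero_ne_one h2

theorem coeff_mul_weightSeries {ι : Type*} (w : ι → ℕ) (a b : ℕ) (d : Fin 2 →₀ ℕ) :
    coeff d (X 0 ^ a * X 1 ^ b * weightSeries w) =
      if b = d 1 ∧ a ≤ d 0 then (weightCount w (d 0 - a) : ℚ) else 0 := by
  have h0 : (d - (Finsupp.single 0 a + Finsupp.single 1 b) : Fin 2 →₀ ℕ) 0 = d 0 - a := by simp
  have h1 : (d - (Finsupp.single 0 a + Finsupp.single 1 b) : Fin 2 →₀ ℕ) 1 = d 1 - b := by simp
  have h2 : (Finsupp.single 0 a + Finsupp.single 1 b : Fin 2 →₀ ℕ) ≤ d ↔ a ≤ d 0 ∧ b ≤ d 1 := by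
    rw [Finsupp.le_def, Fin.forall_fin_two]
    simp
  rw [X_pow_eq, X_pow_eq, monomial_mul_monomial, coeff_monomial_mul, coeff_weightSeries, h0, h1,
    mul_one, one_mul]
  simp only [h2]
  by_cases hb : b = d 1
  · simp [hb]
  · rw [if_neg (show ¬(b = d 1 ∧ a ≤ d 0) from fun h => hb h.1)]
    split_ifs with h3 h4
    · omega
    · rfl
    · rfl

theorem hilbertSeries_eq {F : Type*} [Field F] [Fintype F] {n : ℕ} (I : Composition n) {k e : ℕ}
    (hk : 1 ≤ k) (he₁ : 1 ≤ e) (he : k + e = Fintype.card F - 1) :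
    hilbertSeries F I k = X 0 ^ ((e - 1) * ∑ a : Fin n, Fintype.card F ^ (a : ℕ)) *
      (∏ a : Fin n, (X 1 + X 0 ^ Fintype.card F ^ (a : ℕ))) *
        weightSeries (parDeg (Fintype.card F) I) := by
  classical
  ext d
  rw [Finset.prod_add, Finset.mul_sum, Finset.sum_mul, map_sum]
  have h1 : ∀ s ∈ (Finset.univ : Finset (Fin n)).powerset,
      coeff d (X 0 ^ ((e - 1) * ∑ a : Fin n, Fintype.card F ^ (a : ℕ)) *
        ((∏ _a ∈ s, X 1) * ∏ a ∈ Finset.univ \ s, X 0 ^ Fintype.card F ^ (a : ℕ)) *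
          weightSeries (parDeg (Fintype.card F) I)) =
      if s.card = d 1 then if (e - 1) * ∑ a : Fin n, Fintype.card F ^ (a : ℕ) +
            ∑ a ∈ sᶜ, Fintype.card F ^ (a : ℕ) ≤ d 0 then
          (weightCount (parDeg (Fintype.card F) I) (d 0 - ((e - 1) *
            ∑ a : Fin n, Fintype.card F ^ (a : ℕ) + ∑ a ∈ sᶜ, Fintype.card F ^ (a : ℕ))) : ℚ)
        else 0 else 0 := by
    intro s _
    rw [Finset.prod_const, Finset.prod_pow_eq_pow_sum, mul_comm (X 1 ^ s.card), ← mul_assoc,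
      ← pow_add, coeff_mul_weightSeries, ← ite_and, Finset.compl_eq_univ_sdiff]
  rw [Finset.sum_congr rfl h1, ← Finset.sum_filter]
  refine (congrArg (Nat.cast (R := ℚ)) (finrank_gradedInvariants I hk he₁ he (d 0) (d 1))).trans ?_
  rw [Nat.cast_sum]
  refine Finset.sum_bij (fun s _ => s.val) (fun s _ => ?_) (fun s _ s' _ h => Subtype.ext h)
    (fun s hs => ?_) (fun s _ => ?_)
  · rw [Finset.mem_filter]
    exact ⟨by simp, s.2⟩
  · exact ⟨⟨s, (Finset.mem_filter.1 hs).2⟩, Finset.mem_univ _, rfl⟩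
  · rw [Nat.cast_ite, Nat.cast_zero]

end HilbertSeries

end DicksonMui

end

theorem theoremB {F : Type*} [Field F] [Fintype F] (q : ℕ) (hq : Fintype.card F = q)
    (n : ℕ) (I : Composition n) (k : ℕ) (hk₁ : 1 ≤ k) (hk₂ : k ≤ q - 2)
    (t s : MvPowerSeries (Fin 2) ℚ) (ht : t = MvPowerSeries.X 0) (hs : s = MvPowerSeries.X 1) :
    DicksonMui.hilbertSeries F I k =
      t ^ ((q - 2 - k) * ((q ^ n - 1) / (q - 1))) *
        (∏ i ∈ Finset.range n, (s + t ^ q ^ i)) *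
        (∏ i : Fin I.length, ∏ j ∈ Finset.Icc 1 (I.blocksFun i),
          (1 - t ^ (q ^ I.sizeUpTo (i + 1) - q ^ (I.sizeUpTo (i + 1) - j))))⁻¹ := by
  subst hq ht hs
  have hq : 1 < Fintype.card F := Fintype.one_lt_card
  rw [DicksonMui.hilbertSeries_eq I (e := Fintype.card F - 1 - k) hk₁ (by omega) (by omega),
    DicksonMui.weightSeries_parDeg hq,
    Finset.prod_range fun i => (MvPowerSeries.X 1 + MvPowerSeries.X 0 ^ Fintype.card F ^ i :
      MvPowerSeries (Fin 2) ℚ),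
    Fin.sum_univ_eq_sum_range (fun i => Fintype.card F ^ i) n, Nat.geomSum_eq hq]
  congr 4
  omega
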